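/- Let $d_1,d_2,n\ge 1$, $d=\max(d_1,d_2)$, and $\langle A,B\rangle=\operatorname{tr}(A^\top B)$ on $\mathbb R^{d_1\times d_2}$. Let $\mathcal A\subset\mathbb R^{d_1\times d_2}$ be bounded and let $\pi$ be a probability distribution supported on $\mathcal A$ whose covariance $Q=Q(\pi)=\mathbb E_{A\sim\pi}[\operatorname{vec}(A)\operatorname{vec}(A)^\top]$ is invertible ($\operatorname{vec}$ stacks columns, $\operatorname{reshape}$ is its inverse). For a column index $c$ let $D^{(\mathrm{col})}_c\in\mathbb R^{d_1\times d_1}$ be the principal submatrix of $Q^{-1}$ indexed by the entries of column $c$, for a row index $a$ let $D^{(\mathrm{row})}_a\in\mathbb R^{d_2\times d_2}$ be the one indexed by the entries of row $a$, and put $$B(Q)=\max\Big(\lambda_{\max}\big(\textstyle\sum_{c=1}^{d_2}D^{(\mathrm{col})}_c\big),\ \lambda_{\max}\big(\sum_{a=1}^{d_1}D^{(\mathrm{row})}_a\big)\Big).$$ Let $\Theta^*\in\mathbb R^{d_1\times d_2}$ have rank at most $r$, let $\Theta_0\in\mathbb R^{d_1\times d_2}$ be a fixed pilot estimate with $|\langle\Theta_0-\Theta^*,A\rangle|\le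 R_0$ for all $A\in\mathcal A$, and let $\sigma,R_0\ge 0$ be not both zero and $\delta\in(0,1)$. We observe $(X_i,Y_i)_{i=1}^n$ with $Y_i=\langle\Theta^*,X_i\rangle+\eta_i$, where the pairs $(X_i,\eta_i)$ are independent, $X_i\sim\pi$, $\eta_i$ is square-integrable, $\mathbb E[\eta_i\mid X_i]=0$ and $\mathbb E[\eta_i^2\mid X_i]\le\sigma^2$ almost surely (for instance, $\eta_i$ is centred $\sigma$-sub-Gaussian and independent of $X_i$). Let $\phi:\mathbb R\to\mathbb R$ be continuous with $-\log(1-x+x^2/2)\le\phi(x)\le\log(1+x+x^2/2)$ for all $x$ (for instance $\phi(x)=\operatorname{sign}(x)\log(1+|x|+x^2/2)$), applied to symmetric matrices through their eigenvalues. Let $\mathcal H(M)=\begin{pmatrix}0&M\\M^\top&0\end{pmatrix}$ and let $(\cdot)_{\mathsf{ht}}$ denote the upper right $d_1\times d_2$ block. Put $$\nu=\sqrt{\frac{\ln(2d/\delta)}{(\sigma^2+R_0^2)B(Q)\,n}},\qquad \lambda=2\sqrt{\frac{(\sigma^2+R_0^2)B(Q)\ln(2d/\delta)}{n}},$$ $$M_i=\operatorname{reshape}\big(Q^{-1}(Y_i-\langle\Theta_0,X_i\rangle)\operatorname{vec}(X_i)\big),\qquad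 \Theta_1=\Theta_0+\frac1{n\nu}\Big(\sum_{i=1}^n\phi(\nu\mathcal H(M_i))\Big)_{\mathsf{ht}},$$ and let the thresholded estimator $\hat\Theta$ be obtained from a singular value decomposition of $\Theta_1$ by replacing all singular values that are at most $\lambda$ by $0$. Then there is an event of probability at least $1-\delta$ on which both $$\|\hat\Theta-\Theta^*\|_*\le 8r\sqrt{\frac{(\sigma^2+R_0^2)B(Q)\ln(2d/\delta)}{n}}\quad\text{and}\quad \|\hat\Theta-\Theta^*\|_F\le 4\sqrt{2r}\,\sqrt{\frac{(\sigma^2+R_0^2)B(Q)\ln(2d/\delta)}{n}}.$$ -/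

import Mathlib

open MeasureTheory ProbabilityTheory Matrix

namespace LowPopArt

/-- The product (Borel) σ-algebra on matrices. -/
instance instMeasurableSpaceMatrix {m n : Type*} : MeasurableSpace (Matrix m n ℝ) :=
  inferInstanceAs (MeasurableSpace (m → n → ℝ))

noncomputable section

/-- Trace inner product `⟨A, B⟩ = tr(Aᵀ B)` on real `d₁ × d₂` matrices. -/
def traceInner {d₁ d₂ : ℕ} (A B : Matrix (Fin d₁) (Fin d₂) ℝ) : ℝ :=
  (Aᵀ * B).trace

/-- Frobenius norm. -/
def frobNorm {d₁ d₂ : ℕ} (M : Matrix (Fin d₁) (Fin d₂) ℝ) : ℝ :=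
  √(∑ i, ∑ j, M i j ^ 2)

/-- Nuclear norm: the sum of the singular values. The sequence of singular values is indexed by `ℕ`,
decreasing, and zero from the index `rank M ≤ d₂` on. -/
def nuclearNorm {d₁ d₂ : ℕ} (M : Matrix (Fin d₁) (Fin d₂) ℝ) : ℝ :=
  ∑ k ∈ Finset.range d₂, (toEuclideanLin M).singularValues k

/-- Largest eigenvalue (used for symmetric matrices). -/
def lambdaMax {n : Type*} [Fintype n] [DecidableEq n] (S : Matrix n n ℝ) : ℝ :=
  sSup (spectrum ℝ S)

/-- Inverse of the column-stacking vectorization `Matrix.vec`. -/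
def reshape {d₁ d₂ : ℕ} (v : Fin d₂ × Fin d₁ → ℝ) : Matrix (Fin d₁) (Fin d₂) ℝ :=
  Matrix.of fun i j => v (j, i)

/-- Population covariance `Q(π) = 𝔼_{A ∼ π}[vec(A) vec(A)ᵀ]`. -/
def popCov {d₁ d₂ : ℕ} (π : Measure (Matrix (Fin d₁) (Fin d₂) ℝ)) :
    Matrix (Fin d₂ × Fin d₁) (Fin d₂ × Fin d₁) ℝ :=
  Matrix.of fun p q => ∫ A, vec A p * vec A q ∂π

/-- `D_c^{(col)}`: the diagonal block of `Q⁻¹` formed by the entries of the `c`-th column. -/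
def blockCol {d₁ d₂ : ℕ} (Q : Matrix (Fin d₂ × Fin d₁) (Fin d₂ × Fin d₁) ℝ) (c : Fin d₂) :
    Matrix (Fin d₁) (Fin d₁) ℝ :=
  Matrix.of fun i k => Q⁻¹ (c, i) (c, k)

/-- `D_a^{(row)}`: the principal submatrix of `Q⁻¹` formed by the entries of the `a`-th row. -/
def blockRow {d₁ d₂ : ℕ} (Q : Matrix (Fin d₂ × Fin d₁) (Fin d₂ × Fin d₁) ℝ) (a : Fin d₁) :
    Matrix (Fin d₂) (Fin d₂) ℝ :=
  Matrix.of fun j l => Q⁻¹ (j, a) (l, a)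

/-- `B(Q) = max(λ_max(∑ D^{(col)}), λ_max(∑ D^{(row)}))`. -/
def BQ {d₁ d₂ : ℕ} (Q : Matrix (Fin d₂ × Fin d₁) (Fin d₂ × Fin d₁) ℝ) : ℝ :=
  max (lambdaMax (∑ c, blockCol Q c)) (lambdaMax (∑ a, blockRow Q a))

/-- Self-adjoint dilation `[[0, M], [Mᵀ, 0]]`. -/
def dilation {d₁ d₂ : ℕ} (M : Matrix (Fin d₁) (Fin d₂) ℝ) :
    Matrix (Fin d₁ ⊕ Fin d₂) (Fin d₁ ⊕ Fin d₂) ℝ :=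
  fromBlocks 0 M Mᵀ 0

/-- Influence functions of Catoni type. -/
structure IsInfluence (φ : ℝ → ℝ) : Prop where
  continuous : Continuous φ
  lower : ∀ x, -Real.log (1 - x + x ^ 2 / 2) ≤ φ x
  upper : ∀ x, φ x ≤ Real.log (1 + x + x ^ 2 / 2)

/-- One-sample estimator `reshape(Q⁻¹ (y - ⟨Θ₀, X⟩) vec(X))`. -/
def oneSample {d₁ d₂ : ℕ} (Q : Matrix (Fin d₂ × Fin d₁) (Fin d₂ × Fin d₁) ℝ)
    (Θ₀ X : Matrix (Fin d₁) (Fin d₂) ℝ) (y : ℝ) : Matrix (Fin d₁) (Fin d₂) ℝ :=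
  reshape (Q⁻¹ *ᵥ ((y - traceInner Θ₀ X) • vec X))

/-- Robust mean estimator
`Θ₁ = Θ₀ + ((n ν)⁻¹ ∑ᵢ φ(ν · dilation(Mᵢ)))_ht`, where `Mᵢ` are the one-sample estimators, `φ` acts
on symmetric matrices through their eigenvalues, and `_ht` is the upper right `d₁ × d₂` block. -/
def robustMean {d₁ d₂ n : ℕ} (φ : ℝ → ℝ) (ν : ℝ)
    (Q : Matrix (Fin d₂ × Fin d₁) (Fin d₂ × Fin d₁) ℝ) (Θ₀ : Matrix (Fin d₁) (Fin d₂) ℝ)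
    (X : Fin n → Matrix (Fin d₁) (Fin d₂) ℝ) (y : Fin n → ℝ) : Matrix (Fin d₁) (Fin d₂) ℝ :=
  Θ₀ + ((1 / ((n : ℝ) * ν)) • ∑ i, cfc φ (ν • dilation (oneSample Q Θ₀ (X i) (y i)))).toBlocks₁₂

/-- Hard thresholding of the singular values at level `τ`. With `v_k` an orthonormal eigenbasis of
`Mᵀ M` and `s_k` the singular values, `M v_k = s_k u_k` and `M = ∑ₖ s_k u_k v_kᵀ` is a singular value
decomposition; the terms with `s_k ≤ τ` are removed. -/
def hardThreshold {d₁ d₂ : ℕ} (τ : ℝ) (M : Matrix (Fin d₁) (Fin d₂) ℝ) :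
    Matrix (Fin d₁) (Fin d₂) ℝ :=
  ∑ k : Fin (Module.finrank ℝ (EuclideanSpace ℝ (Fin d₂))),
    if (toEuclideanLin M).singularValues k ≤ τ then 0 else
    let v := (toEuclideanLin M).isSymmetric_adjoint_comp_self.eigenvectorBasis rfl k
    vecMulVec (M *ᵥ v.ofLp) v.ofLp

/-- Truncation parameter `ν = √(ln(2d/δ) / ((σ² + R₀²) B(Q) n))`, `d = max(d₁, d₂)`. -/
def truncParam {d₁ d₂ : ℕ} (Q : Matrix (Fin d₂ × Fin d₁) (Fin d₂ × Fin d₁) ℝ)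
    (σ R₀ δ : ℝ) (n : ℕ) : ℝ :=
  √(Real.log (2 * (max d₁ d₂ : ℕ) / δ) / ((σ ^ 2 + R₀ ^ 2) * BQ Q * n))

/-- Threshold `2 √((σ² + R₀²) B(Q) ln(2d/δ) / n)`, `d = max(d₁, d₂)`. -/
def threshold {d₁ d₂ : ℕ} (Q : Matrix (Fin d₂ × Fin d₁) (Fin d₂ × Fin d₁) ℝ)
    (σ R₀ δ : ℝ) (n : ℕ) : ℝ :=
  2 * √((σ ^ 2 + R₀ ^ 2) * BQ Q * Real.log (2 * (max d₁ d₂ : ℕ) / δ) / n)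

/-- The thresholded estimator computed from a sample `(Xᵢ, yᵢ)`. -/
def lowPopArt {d₁ d₂ n : ℕ} (φ : ℝ → ℝ) (Q : Matrix (Fin d₂ × Fin d₁) (Fin d₂ × Fin d₁) ℝ)
    (σ R₀ δ : ℝ) (Θ₀ : Matrix (Fin d₁) (Fin d₂) ℝ)
    (X : Fin n → Matrix (Fin d₁) (Fin d₂) ℝ) (y : Fin n → ℝ) : Matrix (Fin d₁) (Fin d₂) ℝ :=
  hardThreshold (threshold Q σ R₀ δ n) (robustMean φ (truncParam Q σ R₀ δ n) Q Θ₀ X y)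

/-- Noise model: conditionally on the covariate, the noise has mean zero and variance at most
`σ²`. -/
structure IsNoise {Ω E : Type*} [MeasurableSpace Ω] [mE : MeasurableSpace E] (μ : Measure Ω)
    (σ : ℝ) (X : Ω → E) (η : Ω → ℝ) : Prop where
  measurable : Measurable η
  memLp : MemLp η 2 μ
  condMean : μ[η | mE.comap X] =ᵐ[μ] 0
  condVar : μ[fun ω => η ω ^ 2 | mE.comap X] ≤ᵐ[μ] fun _ => σ ^ 2

/-- The standard example of an influence function. -/
theorem isInfluence_catoni :
    IsInfluence fun x => if 0 ≤ x then Real.log (1 + x + x ^ 2 / 2)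
      else -Real.log (1 - x + x ^ 2 / 2) := by
  have hp : ∀ x : ℝ, 0 < 1 + x + x ^ 2 / 2 := fun x => by nlinarith [sq_nonneg (x + 1)]
  have hm : ∀ x : ℝ, 0 < 1 - x + x ^ 2 / 2 := fun x => by nlinarith [sq_nonneg (x - 1)]
  have key : ∀ x : ℝ, -Real.log (1 - x + x ^ 2 / 2) ≤ Real.log (1 + x + x ^ 2 / 2) := by
    intro x
    have h : 0 ≤ Real.log ((1 + x + x ^ 2 / 2) * (1 - x + x ^ 2 / 2)) :=
      Real.log_nonneg (by nlinarith [sq_nonneg (x ^ 2)])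
    rw [Real.log_mul (hp x).ne' (hm x).ne'] at h
    linarith
  refine ⟨?_, fun x => ?_, fun x => ?_⟩
  · refine Continuous.if_le ?_ ?_ continuous_const continuous_id ?_
    · exact Continuous.log (by fun_prop) fun x => (hp x).ne'
    · exact (Continuous.log (by fun_prop) fun x => (hm x).ne').neg
    · rintro x rfl; simp
  · split_ifs
    · exact key x
    · exact le_rfl
  · split_ifs
    · exact le_rfl
    · exact key x

/-- Centred `σ`-sub-Gaussian noise independent of the covariate satisfies the noise model. -/
theorem IsNoise.of_subgaussian {Ω E : Type*} [MeasurableSpace Ω] [mE : MeasurableSpace E]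
    {μ : Measure Ω} [IsProbabilityMeasure μ] {σ : ℝ} {X : Ω → E} {η : Ω → ℝ}
    (hX : Measurable X) (hη : Measurable η) (hmean : ∫ ω, η ω ∂μ = 0)
    (hsub : HasSubgaussianMGF η ⟨σ ^ 2, sq_nonneg σ⟩ μ) (hind : IndepFun η X μ) :
    IsNoise μ σ X η := by
  have hL : MemLp η 2 μ := by simpa using hsub.memLp 2
  have hi : Integrable (fun ω => η ω ^ 2) μ := hL.integrable_sq
  have hII : Indep (MeasurableSpace.comap η inferInstance) (mE.comap X) μ := hind
  have hvar : ∫ ω, η ω ^ 2 ∂μ ≤ σ ^ 2 := by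
    have h1 : ∀ t : ℝ, t ^ 2 * ∫ ω, η ω ^ 2 ∂μ ≤ 2 * (Real.exp (σ ^ 2 * t ^ 2 / 2) - 1) := by
      intro t
      have ip := hsub.integrable_exp_mul t
      have im := hsub.integrable_exp_mul (-t)
      have bp : ∫ ω, Real.exp (t * η ω) ∂μ ≤ Real.exp (σ ^ 2 * t ^ 2 / 2) := hsub.mgf_le t
      have bm : ∫ ω, Real.exp (-t * η ω) ∂μ ≤ Real.exp (σ ^ 2 * (-t) ^ 2 / 2) := hsub.mgf_le (-t)
      rw [neg_sq] at bm
      have : ∫ ω, t ^ 2 * η ω ^ 2 ∂μ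
          ≤ ∫ ω, (Real.exp (t * η ω) + Real.exp (-t * η ω) - 2) ∂μ := by
        refine integral_mono (hi.const_mul _) ((ip.add im).sub (integrable_const _)) fun ω => ?_
        have e1 : Real.exp (t * η ω) = Real.exp (t * η ω / 2) ^ 2 := by
          rw [← Real.exp_nat_mul]; congr 1; push_cast; ring
        have e2 : Real.exp (-t * η ω) = Real.exp (-(t * η ω / 2)) ^ 2 := by
          rw [← Real.exp_nat_mul]; congr 1; push_cast; ring
        have e3 : Real.exp (t * η ω / 2) * Real.exp (-(t * η ω / 2)) = 1 := by
          rw [← Real.exp_add]; simp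
        have e4 : (t * η ω / 2) ^ 2 ≤ Real.sinh (t * η ω / 2) ^ 2 := by
          rw [sq_le_sq, Real.abs_sinh]
          exact Real.self_le_sinh_iff.2 (abs_nonneg _)
        rw [Real.sinh_eq] at e4
        dsimp only
        rw [e1, e2]
        nlinarith
      have e5 : ∫ ω, (Real.exp (t * η ω) + Real.exp (-t * η ω) - 2) ∂μ
          = ∫ ω, Real.exp (t * η ω) ∂μ + ∫ ω, Real.exp (-t * η ω) ∂μ - 2 := by
        have := integral_sub (ip.add im) (integrable_const (μ := μ) (2 : ℝ))
        have h' := integral_add ip im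
        simp only [Pi.add_apply] at this
        rw [this, h']
        simp
      rw [integral_const_mul, e5] at this
      linarith
    by_contra! hlt
    set v := ∫ ω, η ω ^ 2 ∂μ
    -- choose a small `t`
    obtain ⟨s, hs0, hs1, hs2⟩ : ∃ s : ℝ, 0 < s ∧ σ ^ 2 * s / 2 ≤ 1 ∧
        (σ ^ 2) ^ 2 * s / 2 < v - σ ^ 2 := by
      have c1 : Filter.Tendsto (fun s : ℝ => σ ^ 2 * s / 2) (nhdsWithin 0 (Set.Ioi 0)) (nhds 0) := by
        have : Continuous fun s : ℝ => σ ^ 2 * s / 2 := by fun_prop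
        simpa using (this.tendsto 0).mono_left nhdsWithin_le_nhds
      have c2 : Filter.Tendsto (fun s : ℝ => (σ ^ 2) ^ 2 * s / 2) (nhdsWithin 0 (Set.Ioi 0))
          (nhds 0) := by
        have : Continuous fun s : ℝ => (σ ^ 2) ^ 2 * s / 2 := by fun_prop
        simpa using (this.tendsto 0).mono_left nhdsWithin_le_nhds
      obtain ⟨s, h⟩ := ((c1.eventually (ge_mem_nhds one_pos)).and
        ((c2.eventually (gt_mem_nhds (sub_pos.2 hlt))).and self_mem_nhdsWithin)).exists
      exact ⟨s, h.2.2, h.1, h.2.1⟩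
    have h2 := h1 (√s)
    rw [Real.sq_sqrt hs0.le] at h2
    have hnn : 0 ≤ σ ^ 2 * s / 2 := by positivity
    have h3 := (abs_le.1 (Real.abs_exp_sub_one_sub_id_le
      (x := σ ^ 2 * s / 2) (by rwa [abs_of_nonneg hnn]))).2
    have h4 : s * v ≤ s * (σ ^ 2 + (σ ^ 2) ^ 2 * s / 2) := by nlinarith
    have := le_of_mul_le_mul_left h4 hs0
    linarith
  refine ⟨hη, hL, ?_, ?_⟩
  · have := condExp_indep_eq hη.comap_le hX.comap_le
      (comap_measurable η).stronglyMeasurable hII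
    rw [hmean] at this
    exact this
  · have := condExp_indep_eq hη.comap_le hX.comap_le (f := fun ω => η ω ^ 2)
      ((comap_measurable η).pow_const 2).stronglyMeasurable hII
    filter_upwards [this] with ω h
    rw [h]; exact hvar

end

end LowPopArt

/-! Write `V = (σ² + R₀²) B(Q)` and `L = ln(2d/δ)`. Each one-sample matrix `Mᵢ` is an unbiased
estimate of `Θ* - Θ₀`, and the second moment of its dilation is at most `V` times the identity. The
noise has only two moments, so the sum of the dilations need not concentrate. The influence function
repairs this: `φ(H) ≤ log(1 + H + H²/2)` in the Loewner order, and the expectation of the argument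
of the logarithm involves two moments only.

To use that bound inside a trace exponential one needs Lieb's theorem, `concaveOn_trExp_add_log`.
The Gibbs variational principle writes `tr exp(S + log A)` as a maximum over `T` of a linear term
minus the relative entropy of `T` and `A`. A partial maximum of a jointly concave function is
concave, so joint convexity of the relative entropy suffices (`relEntropy_convex`). The relative
entropy is a limit of integrals of matrix-fractional functions, up to a term linear in `T`, and each
of these is a supremum of functions affine in `(T, A)`. Jensen's inequality, applied to one
independent sample at a time, then bounds the expected trace exponential of the centred sum by `(d₁
+ d₂) exp(nν²V/2)`, and Markov's inequality bounds its largest eigenvalue by `2L`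
(`lintegral_trExp_sum_le`, `lintegral_trExp_influence_le`, `one_sub_le_measureReal_le_exp`).

Only the off-diagonal block of `φ` of a dilation enters the estimator. Replacing `φ` by its odd part
keeps that block and removes the diagonal ones (`cfc_oddPart_dilation`). The centred sum then has
zero diagonal blocks, hence a spectrum symmetric about zero, so the one-sided eigenvalue bound is
already an operator norm bound: `‖Θ₁ - Θ*‖ ≤ λ`.

The rest is deterministic (`hardThreshold_error_le`). At most `r` singular values of `Θ₁` exceed
`λ`, so the error after thresholding has rank at most `2r` and operator norm at most `2λ`. This
controls both norms. -/

namespace LowPopArt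

/-! ### Traces of functions of two symmetric matrices, and the Gibbs variational principle. -/

section Spectral

variable {m : Type*} [Fintype m] [DecidableEq m]

/-- The matrix of `W` in the eigenbases of `A` (rows) and `B` (columns). -/
noncomputable def eigenCoord {A B : Matrix m m ℝ} (hA : A.IsHermitian) (hB : B.IsHermitian)
    (W : Matrix m m ℝ) : Matrix m m ℝ :=
  (hA.eigenvectorUnitary : Matrix m m ℝ)ᵀ * W * (hB.eigenvectorUnitary : Matrix m m ℝ)

/-- Trace of the exponential of a symmetric matrix. -/
noncomputable def trExp (K : Matrix m m ℝ) : ℝ := (cfc Real.exp K).trace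

theorem eigenvectorUnitary_mul_transpose {A : Matrix m m ℝ} (hA : A.IsHermitian) :
    (hA.eigenvectorUnitary : Matrix m m ℝ) * (hA.eigenvectorUnitary : Matrix m m ℝ)ᵀ = 1 := by
  have := Unitary.coe_mul_star_self hA.eigenvectorUnitary
  rwa [Unitary.coe_star, star_eq_conjTranspose, conjTranspose_eq_transpose_of_trivial] at this

theorem transpose_mul_eigenvectorUnitary {A : Matrix m m ℝ} (hA : A.IsHermitian) :
    (hA.eigenvectorUnitary : Matrix m m ℝ)ᵀ * (hA.eigenvectorUnitary : Matrix m m ℝ) = 1 := by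
  have := Unitary.coe_star_mul_self hA.eigenvectorUnitary
  rwa [star_eq_conjTranspose, conjTranspose_eq_transpose_of_trivial] at this

theorem cfc_eq_conj {A : Matrix m m ℝ} (hA : A.IsHermitian) (f : ℝ → ℝ) :
    cfc f A = (hA.eigenvectorUnitary : Matrix m m ℝ) * diagonal (fun i => f (hA.eigenvalues i)) *
      (hA.eigenvectorUnitary : Matrix m m ℝ)ᵀ := by
  rw [hA.cfc_eq, IsHermitian.cfc, Unitary.conjStarAlgAut_apply, star_eq_conjTranspose,
    conjTranspose_eq_transpose_of_trivial]
  rfl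

theorem eq_conj {A : Matrix m m ℝ} (hA : A.IsHermitian) :
    A = (hA.eigenvectorUnitary : Matrix m m ℝ) * diagonal hA.eigenvalues *
      (hA.eigenvectorUnitary : Matrix m m ℝ)ᵀ := by
  conv_lhs => rw [← cfc_id' ℝ A hA.isSelfAdjoint]
  rw [cfc_eq_conj hA]

/-- Cyclicity of the trace absorbs the two eigenvector matrices into `W`. Traces involving two
non-commuting matrices thus become double sums over pairs of eigenvalues with nonnegative weights.
-/
theorem trace_conj_diagonal_mul {A B : Matrix m m ℝ} (hA : A.IsHermitian) (hB : B.IsHermitian)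
    (f g : m → ℝ) (W : Matrix m m ℝ) :
    ((hA.eigenvectorUnitary : Matrix m m ℝ) * diagonal f *
      (hA.eigenvectorUnitary : Matrix m m ℝ)ᵀ * W * ((hB.eigenvectorUnitary : Matrix m m ℝ) *
        diagonal g * (hB.eigenvectorUnitary : Matrix m m ℝ)ᵀ) * Wᵀ).trace
      = ∑ i, ∑ j, f i * g j * eigenCoord hA hB W i j ^ 2 := by
  set U := (hA.eigenvectorUnitary : Matrix m m ℝ)
  set V := (hB.eigenvectorUnitary : Matrix m m ℝ)
  have h : (U * diagonal f * Uᵀ * W * (V * diagonal g * Vᵀ) * Wᵀ).trace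
      = (diagonal f * (Uᵀ * W * V) * diagonal g * (Uᵀ * W * V)ᵀ).trace := by
    rw [show U * diagonal f * Uᵀ * W * (V * diagonal g * Vᵀ) * Wᵀ
      = U * (diagonal f * Uᵀ * W * (V * diagonal g * Vᵀ) * Wᵀ) by simp only [Matrix.mul_assoc],
      trace_mul_comm]
    simp only [transpose_mul, transpose_transpose, Matrix.mul_assoc]
  rw [h, trace]
  refine Finset.sum_congr rfl fun i _ => ?_
  rw [diag_apply, mul_apply]
  refine Finset.sum_congr rfl fun j _ => ?_
  rw [mul_diagonal, diagonal_mul, transpose_apply]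
  simp only [eigenCoord]
  ring

theorem trace_conj_diagonal_mul_eq {A B : Matrix m m ℝ} (hA : A.IsHermitian) (hB : B.IsHermitian)
    (f : m → ℝ) (W : Matrix m m ℝ) :
    ((hA.eigenvectorUnitary : Matrix m m ℝ) * diagonal f *
      (hA.eigenvectorUnitary : Matrix m m ℝ)ᵀ * W).trace
      = ∑ i, ∑ j, f i * eigenCoord hA hB 1 i j * eigenCoord hA hB W i j := by
  have hV := eigenvectorUnitary_mul_transpose hB
  simp only [eigenCoord]
  set U := (hA.eigenvectorUnitary : Matrix m m ℝ)
  set V := (hB.eigenvectorUnitary : Matrix m m ℝ)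
  have h : (U * diagonal f * Uᵀ * W).trace
      = (diagonal f * (Uᵀ * W * V) * (Uᵀ * 1 * V)ᵀ).trace := by
    rw [show U * diagonal f * Uᵀ * W = U * (diagonal f * Uᵀ * W) by simp only [Matrix.mul_assoc],
      trace_mul_comm, Matrix.mul_one, transpose_mul, transpose_transpose,
      show diagonal f * (Uᵀ * W * V) * (Vᵀ * U) = diagonal f * Uᵀ * W * (V * Vᵀ) * U by
        simp only [Matrix.mul_assoc], hV, Matrix.mul_one]
  rw [h, trace]
  refine Finset.sum_congr rfl fun i _ => ?_
  rw [diag_apply, mul_apply]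
  refine Finset.sum_congr rfl fun j _ => ?_
  rw [diagonal_mul, transpose_apply]
  ring

/-- The weights are the squared overlaps of the two eigenbases. Together with the one-matrix
versions below, which use the same weights, this lifts a scalar inequality in a pair of eigenvalues
to a trace inequality. -/
theorem trace_cfc_mul_cfc {A B : Matrix m m ℝ} (hA : A.IsHermitian) (hB : B.IsHermitian)
    (f g : ℝ → ℝ) :
    (cfc f A * cfc g B).trace = ∑ i, ∑ j, eigenCoord hA hB 1 i j ^ 2 *
      (f (hA.eigenvalues i) * g (hB.eigenvalues j)) := by
  have := trace_conj_diagonal_mul hA hB (fun i => f (hA.eigenvalues i))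
    (fun i => g (hB.eigenvalues i)) 1
  rw [cfc_eq_conj hA, cfc_eq_conj hB]
  simp only [Matrix.mul_one, transpose_one] at this ⊢
  rw [this]
  exact Finset.sum_congr rfl fun i _ => Finset.sum_congr rfl fun j _ => by ring

theorem trace_cfc_left {A B : Matrix m m ℝ} (hA : A.IsHermitian) (hB : B.IsHermitian)
    (f : ℝ → ℝ) :
    (cfc f A).trace = ∑ i, ∑ j, eigenCoord hA hB 1 i j ^ 2 * f (hA.eigenvalues i) := by
  have := trace_cfc_mul_cfc hA hB f (fun _ => 1)
  rw [cfc_const_one ℝ B hB.isSelfAdjoint] at this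
  simpa using this

theorem trace_cfc_right {A B : Matrix m m ℝ} (hA : A.IsHermitian) (hB : B.IsHermitian)
    (f : ℝ → ℝ) :
    (cfc f B).trace = ∑ i, ∑ j, eigenCoord hA hB 1 i j ^ 2 * f (hB.eigenvalues j) := by
  have := trace_cfc_mul_cfc hA hB (fun _ => 1) f
  rw [cfc_const_one ℝ A hA.isSelfAdjoint] at this
  simpa using this

theorem trace_cfc {A : Matrix m m ℝ} (hA : A.IsHermitian) (f : ℝ → ℝ) :
    (cfc f A).trace = ∑ i, f (hA.eigenvalues i) := by
  rw [cfc_eq_conj hA, trace_mul_comm, ← Matrix.mul_assoc, transpose_mul_eigenvectorUnitary,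
    Matrix.one_mul, trace_diagonal]

theorem isHermitian_cfc (f : ℝ → ℝ) (A : Matrix m m ℝ) : (cfc f A).IsHermitian :=
  (cfc_predicate f A : IsSelfAdjoint _)

theorem continuousOn_spectrum (f : ℝ → ℝ) (A : Matrix m m ℝ) :
    ContinuousOn f (spectrum ℝ A) :=
  (Matrix.finite_real_spectrum (A := A)).continuousOn f

theorem posSemidef_cfc {A : Matrix m m ℝ} (hA : A.IsHermitian) {f : ℝ → ℝ}
    (hf : ∀ i, 0 ≤ f (hA.eigenvalues i)) : (cfc f A).PosSemidef := by
  rw [cfc_eq_conj hA]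
  have := (PosSemidef.diagonal (d := fun i => f (hA.eigenvalues i)) (fun i => hf i)
    ).mul_mul_conjTranspose_same (hA.eigenvectorUnitary : Matrix m m ℝ)
  rwa [conjTranspose_eq_transpose_of_trivial] at this

theorem posDef_cfc {A : Matrix m m ℝ} (hA : A.IsHermitian) {f : ℝ → ℝ}
    (hf : ∀ i, 0 < f (hA.eigenvalues i)) : (cfc f A).PosDef := by
  rw [cfc_eq_conj hA]
  have h1 : (diagonal (fun i => f (hA.eigenvalues i))).PosDef := PosDef.diagonal fun i => hf i
  have := h1.mul_mul_conjTranspose_same (B := (hA.eigenvectorUnitary : Matrix m m ℝ)) ?_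
  · rwa [conjTranspose_eq_transpose_of_trivial] at this
  · intro v w h
    have := congrArg (fun u => u ᵥ* (hA.eigenvectorUnitary : Matrix m m ℝ)ᵀ) h
    simpa [vecMul_vecMul, eigenvectorUnitary_mul_transpose] using this

/-- `cfc` is monotone in the function, in the Loewner order. -/
theorem posSemidef_cfc_sub_cfc {A : Matrix m m ℝ} (hA : A.IsHermitian) {f g : ℝ → ℝ}
    (hfg : ∀ i, f (hA.eigenvalues i) ≤ g (hA.eigenvalues i)) : (cfc g A - cfc f A).PosSemidef := by
  rw [← cfc_sub g f A (continuousOn_spectrum _ _) (continuousOn_spectrum _ _)]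
  exact posSemidef_cfc hA fun i => sub_nonneg.2 (hfg i)

theorem trace_mul_nonneg {A B : Matrix m m ℝ} (hA : A.PosSemidef) (hB : B.PosSemidef) :
    0 ≤ (A * B).trace := by
  have h := trace_cfc_mul_cfc hA.1 hB.1 id id
  rw [cfc_id ℝ A hA.1.isSelfAdjoint, cfc_id ℝ B hB.1.isSelfAdjoint] at h
  rw [h]
  exact Finset.sum_nonneg fun i _ => Finset.sum_nonneg fun j _ =>
    mul_nonneg (sq_nonneg _) (mul_nonneg (hA.eigenvalues_nonneg i) (hB.eigenvalues_nonneg j))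

/-- Gibbs variational inequality. -/
theorem trace_mul_sub_entropy_le_trExp {T K : Matrix m m ℝ} (hT : T.PosDef) (hK : K.IsHermitian) :
    (T * K).trace - (cfc (fun x => x * Real.log x) T).trace + T.trace ≤ trExp K := by
  have h1 := trace_cfc_mul_cfc hT.1 hK id id
  have h2 := trace_cfc_left hT.1 hK id
  rw [cfc_id ℝ T hT.1.isSelfAdjoint] at h1 h2
  rw [cfc_id ℝ K hK.isSelfAdjoint] at h1
  rw [trExp, h1, h2, trace_cfc_left hT.1 hK, trace_cfc_right hT.1 hK, ← Finset.sum_sub_distrib,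
    ← Finset.sum_add_distrib]
  refine Finset.sum_le_sum fun i _ => ?_
  rw [← Finset.sum_sub_distrib, ← Finset.sum_add_distrib]
  refine Finset.sum_le_sum fun j _ => ?_
  rw [← mul_sub, ← mul_add]
  refine mul_le_mul_of_nonneg_left ?_ (sq_nonneg _)
  have ht := hT.eigenvalues_pos i
  set t := hT.1.eigenvalues i
  set k := hK.eigenvalues j
  -- The scalar inequality `t k - t log t + t ≤ exp k` is the tangent bound for `exp` at `0`,
  -- multiplied by `t`.
  have h := Real.add_one_le_exp (k - Real.log t)
  rw [Real.exp_sub, Real.exp_log ht, le_div_iff₀ ht] at h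
  simp only [id]
  linarith

theorem posDef_cfc_exp {K : Matrix m m ℝ} (hK : K.IsHermitian) : (cfc Real.exp K).PosDef :=
  posDef_cfc hK fun _ => Real.exp_pos _

/-- Equality case of the Gibbs variational inequality. -/
theorem trExp_eq {K : Matrix m m ℝ} (hK : K.IsHermitian) :
    trExp K = (cfc Real.exp K * K).trace
      - (cfc (fun x => x * Real.log x) (cfc Real.exp K)).trace + (cfc Real.exp K).trace := by
  rw [← cfc_comp' (fun x => x * Real.log x) Real.exp K
    ((Matrix.finite_real_spectrum (A := K)).image _ |>.continuousOn _) (continuousOn_spectrum _ _)]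
  have h : (fun x => Real.exp x * Real.log (Real.exp x)) = fun x => Real.exp x * x := by
    ext x; rw [Real.log_exp]
  have h1 := cfc_mul Real.exp (fun x => x) K (continuousOn_spectrum _ _) (continuousOn_spectrum _ _)
  rw [cfc_id' ℝ K hK.isSelfAdjoint] at h1
  rw [h, h1, sub_self, zero_add, trExp]

/-- The optimiser `exp K` of the variational problem for `K` serves as a trial matrix for `L`; no
operator monotonicity of `exp` is needed, and indeed it fails. -/
theorem trExp_mono {K L : Matrix m m ℝ} (hK : K.IsHermitian) (hL : L.IsHermitian)
    (h : (L - K).PosSemidef) : trExp K ≤ trExp L := by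
  have h1 := trace_mul_sub_entropy_le_trExp (posDef_cfc_exp hK) hL
  have h2 := trace_mul_nonneg (posDef_cfc_exp hK).posSemidef h
  rw [Matrix.mul_sub, trace_sub] at h2
  rw [trExp_eq hK]
  linarith

theorem trExp_nonneg {K : Matrix m m ℝ} (hK : K.IsHermitian) : 0 ≤ trExp K := by
  rw [trExp, trace_cfc hK]
  exact Finset.sum_nonneg fun i _ => (Real.exp_pos _).le

end Spectral

end LowPopArt

namespace LowPopArt

/-! ### Joint convexity of the quantum relative entropy and Lieb's concavity theorem. -/

section Lieb

variable {m : Type*} [Fintype m] [DecidableEq m]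

/-- The matrix-fractional function `tr(T (A + s T)⁻¹ T)`, where `A` acts from the right and `T`
from the left, written in the eigenbases of `T` and `A`. -/
noncomputable def fracForm {T A : Matrix m m ℝ} (hT : T.IsHermitian) (hA : A.IsHermitian) (s : ℝ) :
    ℝ :=
  ∑ i, ∑ j, eigenCoord hT hA 1 i j ^ 2 *
    (hT.eigenvalues i ^ 2 / (hA.eigenvalues j + s * hT.eigenvalues i))

/-- The affine minorants of the matrix-fractional function. -/
noncomputable def fracMinorant (W : Matrix m m ℝ) (s : ℝ) (T A : Matrix m m ℝ) : ℝ :=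
  2 * (T * W).trace - (W * A * Wᵀ).trace - s * (T * W * Wᵀ).trace

theorem fracMinorant_eq_sum {T A : Matrix m m ℝ} (hT : T.IsHermitian) (hA : A.IsHermitian)
    (W : Matrix m m ℝ) (s : ℝ) :
    fracMinorant W s T A = ∑ i, ∑ j,
      (2 * hT.eigenvalues i * eigenCoord hT hA 1 i j * eigenCoord hT hA W i j
        - (hA.eigenvalues j + s * hT.eigenvalues i) * eigenCoord hT hA W i j ^ 2) := by
  have h1 := trace_conj_diagonal_mul_eq hT hA hT.eigenvalues W
  have h2 := trace_conj_diagonal_mul hT hA (fun _ => 1) hA.eigenvalues W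
  have h3 := trace_conj_diagonal_mul hT hA hT.eigenvalues (fun _ => 1) W
  rw [← eq_conj] at h1
  rw [diagonal_one, Matrix.mul_one, eigenvectorUnitary_mul_transpose, Matrix.one_mul,
    ← eq_conj] at h2
  rw [diagonal_one, Matrix.mul_one, eigenvectorUnitary_mul_transpose, Matrix.mul_one,
    ← eq_conj] at h3
  rw [fracMinorant, h1, h2, h3]
  simp only [Finset.mul_sum, ← Finset.sum_sub_distrib]
  exact Finset.sum_congr rfl fun i _ => Finset.sum_congr rfl fun j _ => by ring

/-- In eigencoordinates this is termwise completion of the square in the entries of `W`. -/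
theorem fracMinorant_le_fracForm {T A : Matrix m m ℝ} (hT : T.PosDef) (hA : A.PosDef)
    (W : Matrix m m ℝ) {s : ℝ} (hs : 0 ≤ s) :
    fracMinorant W s T A ≤ fracForm hT.1 hA.1 s := by
  rw [fracMinorant_eq_sum hT.1 hA.1, fracForm]
  refine Finset.sum_le_sum fun i _ => Finset.sum_le_sum fun j _ => ?_
  have ht := hT.eigenvalues_pos i
  have ha := hA.eigenvalues_pos j
  have hd : 0 < hA.1.eigenvalues j + s * hT.1.eigenvalues i := by positivity
  generalize hT.1.eigenvalues i = t at *
  generalize hA.1.eigenvalues j + s * t = d at *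
  generalize eigenCoord hT.1 hA.1 1 i j = c
  generalize eigenCoord hT.1 hA.1 W i j = w
  rw [mul_div_assoc', le_div_iff₀ hd]
  nlinarith [sq_nonneg (c * t - d * w)]

theorem exists_fracMinorant_eq {T A : Matrix m m ℝ} (hT : T.PosDef) (hA : A.PosDef)
    {s : ℝ} (hs : 0 ≤ s) :
    ∃ W, fracMinorant W s T A = fracForm hT.1 hA.1 s := by
  -- The entries for which every completed square vanishes; conjugating back to the standard basis
  -- gives the optimal `W`.
  set w : Matrix m m ℝ := Matrix.of fun i j => hT.1.eigenvalues i * eigenCoord hT.1 hA.1 1 i j /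
    (hA.1.eigenvalues j + s * hT.1.eigenvalues i) with hw
  refine ⟨(hT.1.eigenvectorUnitary : Matrix m m ℝ) * w *
    (hA.1.eigenvectorUnitary : Matrix m m ℝ)ᵀ, ?_⟩
  have hc : eigenCoord hT.1 hA.1 ((hT.1.eigenvectorUnitary : Matrix m m ℝ) * w *
      (hA.1.eigenvectorUnitary : Matrix m m ℝ)ᵀ) = w := by
    rw [eigenCoord, Matrix.mul_assoc, Matrix.mul_assoc, transpose_mul_eigenvectorUnitary,
      Matrix.mul_one, ← Matrix.mul_assoc, transpose_mul_eigenvectorUnitary, Matrix.one_mul]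
  rw [fracMinorant_eq_sum hT.1 hA.1, fracForm, hc]
  refine Finset.sum_congr rfl fun i _ => Finset.sum_congr rfl fun j _ => ?_
  have ht := hT.eigenvalues_pos i
  have ha := hA.eigenvalues_pos j
  have hd : 0 < hA.1.eigenvalues j + s * hT.1.eigenvalues i := by positivity
  rw [hw, Matrix.of_apply]
  field_simp
  ring

/-- A supremum of functions linear in `(T, A)` is convex: the `W` optimal at the mixture is a
competitor at both endpoints. -/
theorem fracForm_convex {T₁ T₂ A₁ A₂ : Matrix m m ℝ} (hT₁ : T₁.PosDef) (hT₂ : T₂.PosDef)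
    (hA₁ : A₁.PosDef) (hA₂ : A₂.PosDef) {p q : ℝ} (hp : 0 < p) (hq : 0 < q)
    (hT : (p • T₁ + q • T₂).PosDef) (hA : (p • A₁ + q • A₂).PosDef) {s : ℝ} (hs : 0 ≤ s) :
    fracForm hT.1 hA.1 s ≤ p * fracForm hT₁.1 hA₁.1 s + q * fracForm hT₂.1 hA₂.1 s := by
  obtain ⟨W, hW⟩ := exists_fracMinorant_eq hT hA hs
  have h : fracMinorant W s (p • T₁ + q • T₂) (p • A₁ + q • A₂)
      = p * fracMinorant W s T₁ A₁ + q * fracMinorant W s T₂ A₂ := by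
    simp only [fracMinorant, Matrix.add_mul, Matrix.mul_add, Matrix.smul_mul, Matrix.mul_smul,
      trace_add, trace_smul, smul_eq_mul]
    ring
  rw [← hW, h]
  exact add_le_add
    (mul_le_mul_of_nonneg_left (fracMinorant_le_fracForm hT₁ hA₁ W hs) hp.le)
    (mul_le_mul_of_nonneg_left (fracMinorant_le_fracForm hT₂ hA₂ W hs) hq.le)

theorem hasDerivAt_mul_log {t a s : ℝ} (ht : 0 < t) (ha : 0 < a) (hs : 0 ≤ s) :
    HasDerivAt (fun s => t * Real.log (a + s * t)) (t ^ 2 / (a + s * t)) s := by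
  have h1 : HasDerivAt (fun s : ℝ => a + s * t) t s := by
    simpa using ((hasDerivAt_id s).mul_const t).const_add a
  have := (h1.log (by positivity)).const_mul t
  refine this.congr_deriv ?_
  rw [sq, mul_div_assoc]

theorem intervalIntegrable_frac {t a N : ℝ} (ht : 0 < t) (ha : 0 < a) (hN : 0 ≤ N) :
    IntervalIntegrable (fun s => t ^ 2 / (a + s * t)) volume 0 N := by
  refine ContinuousOn.intervalIntegrable ?_
  rw [Set.uIcc_of_le hN]
  refine continuousOn_const.div (by fun_prop) fun s hs => ?_
  have := hs.1
  positivity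

theorem integral_frac {t a N : ℝ} (ht : 0 < t) (ha : 0 < a) (hN : 0 ≤ N) :
    ∫ s in (0 : ℝ)..N, t ^ 2 / (a + s * t) = t * Real.log (a + N * t) - t * Real.log a := by
  rw [intervalIntegral.integral_eq_sub_of_hasDerivAt (f := fun s => t * Real.log (a + s * t))
    (fun s hs => hasDerivAt_mul_log ht ha ?_) (intervalIntegrable_frac ht ha hN)]
  · simp
  · rw [Set.uIcc_of_le hN] at hs
    exact hs.1

theorem intervalIntegrable_fracForm {T A : Matrix m m ℝ} (hT : T.PosDef) (hA : A.PosDef)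
    {N : ℝ} (hN : 0 ≤ N) : IntervalIntegrable (fracForm hT.1 hA.1) volume 0 N := by
  unfold fracForm
  have : ∀ i j, IntervalIntegrable (fun s => eigenCoord hT.1 hA.1 1 i j ^ 2 *
      (hT.1.eigenvalues i ^ 2 / (hA.1.eigenvalues j + s * hT.1.eigenvalues i))) volume 0 N :=
    fun i j => (intervalIntegrable_frac (hT.eigenvalues_pos i) (hA.eigenvalues_pos j) hN).const_mul _
  have h := IntervalIntegrable.sum Finset.univ
    (fun i _ => IntervalIntegrable.sum Finset.univ (fun j _ => this i j))
  simpa only [Finset.sum_fn] using h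

theorem integral_fracForm {T A : Matrix m m ℝ} (hT : T.PosDef) (hA : A.PosDef)
    {N : ℝ} (hN : 0 ≤ N) :
    ∫ s in (0 : ℝ)..N, fracForm hT.1 hA.1 s = ∑ i, ∑ j, eigenCoord hT.1 hA.1 1 i j ^ 2 *
      (hT.1.eigenvalues i * Real.log (hA.1.eigenvalues j + N * hT.1.eigenvalues i)
        - hT.1.eigenvalues i * Real.log (hA.1.eigenvalues j)) := by
  unfold fracForm
  have : ∀ i j, IntervalIntegrable (fun s => eigenCoord hT.1 hA.1 1 i j ^ 2 *
      (hT.1.eigenvalues i ^ 2 / (hA.1.eigenvalues j + s * hT.1.eigenvalues i))) volume 0 N :=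
    fun i j => (intervalIntegrable_frac (hT.eigenvalues_pos i) (hA.eigenvalues_pos j) hN).const_mul _
  rw [intervalIntegral.integral_finsetSum]
  · refine Finset.sum_congr rfl fun i _ => ?_
    rw [intervalIntegral.integral_finsetSum fun j _ => this i j]
    refine Finset.sum_congr rfl fun j _ => ?_
    rw [intervalIntegral.integral_const_mul,
      integral_frac (hT.eigenvalues_pos i) (hA.eigenvalues_pos j) hN]
  · intro i _
    have h := IntervalIntegrable.sum Finset.univ (fun j _ => this i j)
    simpa only [Finset.sum_fn] using h

/-- Quantum relative entropy `tr(T log T) - tr(T log A)`. -/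
noncomputable def relEntropy (T A : Matrix m m ℝ) : ℝ :=
  (cfc (fun x => x * Real.log x) T).trace - (T * cfc Real.log A).trace

theorem relEntropy_eq_sum {T A : Matrix m m ℝ} (hT : T.IsHermitian) (hA : A.IsHermitian) :
    relEntropy T A = ∑ i, ∑ j, eigenCoord hT hA 1 i j ^ 2 *
      (hT.eigenvalues i * Real.log (hT.eigenvalues i)
        - hT.eigenvalues i * Real.log (hA.eigenvalues j)) := by
  have h1 := trace_cfc_mul_cfc hT hA (fun x => x) Real.log
  rw [cfc_id' ℝ T hT.isSelfAdjoint] at h1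
  rw [relEntropy, trace_cfc_left hT hA, h1, ← Finset.sum_sub_distrib]
  refine Finset.sum_congr rfl fun i _ => ?_
  rw [← Finset.sum_sub_distrib]
  exact Finset.sum_congr rfl fun j _ => by ring

/-- The integral up to `N` produces `t log(a + N t) - t log a`, which diverges like `t log N`. The
compensator is linear in `T`, so it does not affect convexity. -/
theorem tendsto_integral_fracForm {T A : Matrix m m ℝ} (hT : T.PosDef) (hA : A.PosDef) :
    Filter.Tendsto (fun N : ℝ => (∫ s in (0 : ℝ)..N, fracForm hT.1 hA.1 s) - T.trace * Real.log N)
      Filter.atTop (nhds (relEntropy T A)) := by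
  have h0 : T.trace = ∑ i, ∑ j, eigenCoord hT.1 hA.1 1 i j ^ 2 * hT.1.eigenvalues i := by
    have := trace_cfc_left hT.1 hA.1 (fun x => x)
    rwa [cfc_id' ℝ T hT.1.isSelfAdjoint] at this
  have key : Filter.Tendsto (fun N : ℝ => ∑ i, ∑ j, eigenCoord hT.1 hA.1 1 i j ^ 2 *
      (hT.1.eigenvalues i * Real.log (hA.1.eigenvalues j / N + hT.1.eigenvalues i)
        - hT.1.eigenvalues i * Real.log (hA.1.eigenvalues j)))
      Filter.atTop (nhds (relEntropy T A)) := by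
    rw [relEntropy_eq_sum hT.1 hA.1]
    refine tendsto_finsetSum _ fun i _ => tendsto_finsetSum _ fun j _ => ?_
    refine Filter.Tendsto.const_mul _ (Filter.Tendsto.sub_const (Filter.Tendsto.const_mul _ ?_) _)
    have h1 : Filter.Tendsto (fun N : ℝ => hA.1.eigenvalues j / N + hT.1.eigenvalues i)
        Filter.atTop (nhds (0 + hT.1.eigenvalues i)) :=
      (tendsto_const_nhds.div_atTop Filter.tendsto_id).add_const _
    rw [zero_add] at h1
    exact h1.log (hT.eigenvalues_pos i).ne'
  refine key.congr' ?_
  filter_upwards [Filter.eventually_gt_atTop 0] with N hN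
  rw [integral_fracForm hT hA hN.le, h0, Finset.sum_mul, ← Finset.sum_sub_distrib]
  refine Finset.sum_congr rfl fun i _ => ?_
  rw [Finset.sum_mul, ← Finset.sum_sub_distrib]
  refine Finset.sum_congr rfl fun j _ => ?_
  have ht := hT.eigenvalues_pos i
  have ha := hA.eigenvalues_pos j
  rw [show hA.1.eigenvalues j / N + hT.1.eigenvalues i
    = (hA.1.eigenvalues j + N * hT.1.eigenvalues i) / N by field_simp,
    Real.log_div (by positivity) hN.ne']
  ring

/-- Joint convexity of the quantum relative entropy. -/
theorem relEntropy_convex {T₁ T₂ A₁ A₂ : Matrix m m ℝ} (hT₁ : T₁.PosDef) (hT₂ : T₂.PosDef)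
    (hA₁ : A₁.PosDef) (hA₂ : A₂.PosDef) {p q : ℝ} (hp : 0 < p) (hq : 0 < q)
    (hT : (p • T₁ + q • T₂).PosDef) (hA : (p • A₁ + q • A₂).PosDef) :
    relEntropy (p • T₁ + q • T₂) (p • A₁ + q • A₂)
      ≤ p * relEntropy T₁ A₁ + q * relEntropy T₂ A₂ := by
  -- At each finite `N` the inequality is the integrated convexity of `fracForm`; the compensators
  -- on the two sides cancel.
  refine le_of_tendsto_of_tendsto (tendsto_integral_fracForm hT hA)
    (((tendsto_integral_fracForm hT₁ hA₁).const_mul p).add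
      ((tendsto_integral_fracForm hT₂ hA₂).const_mul q)) ?_
  filter_upwards [Filter.eventually_ge_atTop 0] with N hN
  have i1 := (intervalIntegrable_fracForm hT₁ hA₁ hN).const_mul p
  have i2 := (intervalIntegrable_fracForm hT₂ hA₂ hN).const_mul q
  have h := intervalIntegral.integral_mono_on hN (intervalIntegrable_fracForm hT hA hN) (i1.add i2)
    fun s hs => fracForm_convex hT₁ hT₂ hA₁ hA₂ hp hq hT hA hs.1
  rw [intervalIntegral.integral_add i1 i2, intervalIntegral.integral_const_mul,
    intervalIntegral.integral_const_mul] at h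
  rw [trace_add, trace_smul, trace_smul, smul_eq_mul, smul_eq_mul]
  linarith

/-- Equality in the Gibbs principle, with the term in `log A` merged with the entropy so that `A`
enters only through the relative entropy. -/
theorem trExp_add_log {S A : Matrix m m ℝ} (hS : S.IsHermitian) :
    trExp (S + cfc Real.log A) = (cfc Real.exp (S + cfc Real.log A) * S).trace
      - relEntropy (cfc Real.exp (S + cfc Real.log A)) A
      + (cfc Real.exp (S + cfc Real.log A)).trace := by
  rw [trExp_eq (hS.add (isHermitian_cfc _ _)), relEntropy, Matrix.mul_add, trace_add]
  ring

/-- **Lieb's concavity theorem**: `A ↦ tr exp(S + log A)` is concave on positive definite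
matrices. -/
theorem concaveOn_trExp_add_log {S : Matrix m m ℝ} (hS : S.IsHermitian) :
    ConcaveOn ℝ {A : Matrix m m ℝ | A.PosDef} fun A => trExp (S + cfc Real.log A) := by
  have hc : Convex ℝ {A : Matrix m m ℝ | A.PosDef} := by
    rw [convex_iff_forall_pos]
    exact fun A hA B hB p q hp hq _ => (PosDef.smul hA hp).add (PosDef.smul hB hq)
  refine concaveOn_iff_forall_pos.2 ⟨hc, fun A₁ hA₁ A₂ hA₂ p q hp hq hpq => ?_⟩
  have hT₁ := posDef_cfc_exp (hS.add (isHermitian_cfc Real.log A₁))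
  have hT₂ := posDef_cfc_exp (hS.add (isHermitian_cfc Real.log A₂))
  rw [trExp_add_log hS (A := A₁), trExp_add_log hS (A := A₂)]
  set T₁ := cfc Real.exp (S + cfc Real.log A₁)
  set T₂ := cfc Real.exp (S + cfc Real.log A₂)
  have hT : (p • T₁ + q • T₂).PosDef := (hT₁.smul hp).add (hT₂.smul hq)
  have hA : (p • A₁ + q • A₂).PosDef := (PosDef.smul hA₁ hp).add (PosDef.smul hA₂ hq)
  have h1 := relEntropy_convex hT₁ hT₂ hA₁ hA₂ hp hq hT hA
  -- The mixture of the two optimisers is a trial matrix at the mixed argument.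
  have h2 := trace_mul_sub_entropy_le_trExp hT (hS.add (isHermitian_cfc Real.log (p • A₁ + q • A₂)))
  have h3 : ((p • T₁ + q • T₂) * S).trace = p * (T₁ * S).trace + q * (T₂ * S).trace := by
    simp [Matrix.add_mul]
  have h4 : (p • T₁ + q • T₂).trace = p * T₁.trace + q * T₂.trace := by simp
  have h5 : relEntropy (p • T₁ + q • T₂) (p • A₁ + q • A₂)
    = (cfc (fun x => x * Real.log x) (p • T₁ + q • T₂)).trace
      - ((p • T₁ + q • T₂) * cfc Real.log (p • A₁ + q • A₂)).trace := rfl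
  rw [Matrix.mul_add, trace_add] at h2
  simp only [smul_eq_mul]
  linarith

end Lieb

end LowPopArt

namespace LowPopArt

/-! ### Measurability, Jensen's inequality for the trace exponential, and independent sums. -/

section Jensen

variable {m : Type*} [Fintype m] [DecidableEq m]

instance instBorelSpaceMatrix {m n : Type*} [Countable m] [Countable n] :
    BorelSpace (Matrix m n ℝ) :=
  inferInstanceAs (BorelSpace (m → n → ℝ))

instance instSecondCountableTopologyMatrix {m n : Type*} [Countable m] [Countable n] :
    SecondCountableTopology (Matrix m n ℝ) :=
  inferInstanceAs (SecondCountableTopology (m → n → ℝ))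

open scoped Matrix.Norms.L2Operator in
theorem continuous_cfc {X : Type*} [TopologicalSpace X] {f : ℝ → ℝ} (hf : Continuous f)
    {K : X → Matrix m m ℝ} (hK : Continuous K) (hKs : ∀ x, (K x).IsHermitian) :
    Continuous fun x => cfc f (K x) :=
  hK.cfc_of_mem_nhdsSet (p := IsSelfAdjoint) (s := Set.univ) f Filter.univ_mem
    (fun x => (hKs x).isSelfAdjoint) hf.continuousOn

open scoped Matrix.Norms.L2Operator in
theorem continuousOn_cfc_log :
    ContinuousOn (fun A : Matrix m m ℝ => cfc Real.log A) {A | A.PosDef} := by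
  refine continuousOn_id.cfc_of_mem_nhdsSet (p := IsSelfAdjoint) (s := Set.Ioi 0) Real.log
    (isOpen_Ioi.mem_nhdsSet.2 ?_) (fun A hA => (PosDef.isHermitian hA).isSelfAdjoint)
    (Real.continuousOn_log.mono fun x hx => (Set.mem_Ioi.1 hx).ne')
  refine Set.iUnion₂_subset fun A hA => ?_
  have hA : A.PosDef := hA
  rw [hA.1.spectrum_real_eq_range_eigenvalues]
  rintro _ ⟨i, rfl⟩
  exact hA.eigenvalues_pos i

theorem continuous_trExp {X : Type*} [TopologicalSpace X]
    {K : X → Matrix m m ℝ} (hK : Continuous K) (hKs : ∀ x, (K x).IsHermitian) :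
    Continuous fun x => trExp (K x) :=
  (continuous_cfc Real.continuous_exp hK hKs).matrix_trace

/-- Composing with the symmetric part extends a spectral function continuously from symmetric
matrices to all matrices. Measurability can then be checked on the whole space. -/
theorem isHermitian_half_add_transpose (K : Matrix m m ℝ) :
    ((1 / 2 : ℝ) • (K + Kᵀ)).IsHermitian := by
  rw [IsHermitian, conjTranspose_eq_transpose_of_trivial, transpose_smul, transpose_add,
    transpose_transpose, add_comm]

theorem half_add_transpose_eq {K : Matrix m m ℝ} (hK : K.IsHermitian) :
    (1 / 2 : ℝ) • (K + Kᵀ) = K := by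
  rw [IsHermitian, conjTranspose_eq_transpose_of_trivial] at hK
  rw [hK, ← two_smul ℝ K, smul_smul]
  norm_num

theorem measurable_cfc {X : Type*} [MeasurableSpace X] {f : ℝ → ℝ} (hf : Continuous f)
    {K : X → Matrix m m ℝ} (hK : Measurable K) (hKs : ∀ x, (K x).IsHermitian) :
    Measurable fun x => cfc f (K x) := by
  have h : Continuous fun K : Matrix m m ℝ => cfc f ((1 / 2 : ℝ) • (K + Kᵀ)) :=
    continuous_cfc hf (by fun_prop) isHermitian_half_add_transpose
  simpa only [Function.comp_def, half_add_transpose_eq (hKs _)] using h.measurable.comp hK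

theorem continuous_trExp_half_add_transpose :
    Continuous fun K : Matrix m m ℝ => trExp ((1 / 2 : ℝ) • (K + Kᵀ)) :=
  continuous_trExp (by fun_prop) isHermitian_half_add_transpose

theorem measurable_trExp {X : Type*} [MeasurableSpace X]
    {K : X → Matrix m m ℝ} (hK : Measurable K) (hKs : ∀ x, (K x).IsHermitian) :
    Measurable fun x => trExp (K x) := by
  simpa only [Function.comp_def, half_add_transpose_eq (hKs _)] using
    continuous_trExp_half_add_transpose.measurable.comp hK

theorem isHermitian_smul_one (c : ℝ) : (c • (1 : Matrix m m ℝ)).IsHermitian := by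
  rw [IsHermitian, conjTranspose_smul, conjTranspose_one, star_trivial]

theorem trExp_add_smul_one {S : Matrix m m ℝ} (hS : S.IsHermitian) (c : ℝ) :
    trExp (S + c • 1) = Real.exp c * trExp S := by
  have h := cfc_add_const c (fun x => x) S (continuousOn_spectrum _ _) hS.isSelfAdjoint
  rw [cfc_id' ℝ S hS.isSelfAdjoint, Algebra.algebraMap_eq_smul_one] at h
  rw [trExp, trExp, ← h, ← cfc_comp' Real.exp (fun x => x + c) S
    Real.continuous_exp.continuousOn (continuousOn_spectrum _ _) hS.isSelfAdjoint,
    trace_cfc hS, trace_cfc hS, Finset.mul_sum]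
  exact Finset.sum_congr rfl fun i _ => by rw [Real.exp_add, mul_comm]

theorem trExp_smul_one (c : ℝ) :
    trExp (c • (1 : Matrix m m ℝ)) = Fintype.card m * Real.exp c := by
  have h := trExp_add_smul_one (m := m) isHermitian_zero c
  rw [zero_add] at h
  rw [h, trExp, cfc_apply_zero, Real.exp_zero, map_one, trace_one, mul_comm]

/-- The trace exponential dominates the exponential of the largest eigenvalue. -/
theorem posSemidef_log_trExp_sub {K : Matrix m m ℝ} (hK : K.IsHermitian) :
    (Real.log (trExp K) • (1 : Matrix m m ℝ) - K).PosSemidef := by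
  have h := posSemidef_cfc_sub_cfc hK (f := fun x => x) (g := fun _ => Real.log (trExp K)) ?_
  · rwa [cfc_const _ _ hK.isSelfAdjoint, cfc_id' ℝ K hK.isSelfAdjoint,
      Algebra.algebraMap_eq_smul_one] at h
  · intro i
    have h1 : Real.exp (hK.eigenvalues i) ≤ trExp K := by
      rw [trExp, trace_cfc hK]
      exact Finset.single_le_sum (f := fun i => Real.exp (hK.eigenvalues i))
        (fun i _ => (Real.exp_pos _).le) (Finset.mem_univ i)
    rwa [Real.le_log_iff_exp_le ((Real.exp_pos _).trans_le h1)]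

/-- A crude bound, linear in `A`, that supplies the integrability needed for Jensen's inequality. It
follows from `log A ≤ log(tr A)` times the identity. -/
theorem trExp_add_log_le {S A : Matrix m m ℝ} (hS : S.IsHermitian) (hA : A.PosDef) :
    trExp (S + cfc Real.log A) ≤ A.trace * trExp S := by
  have hA' : A.trace = ∑ i, hA.1.eigenvalues i := by
    have := trace_cfc hA.1 (fun x => x)
    rwa [cfc_id' ℝ A hA.1.isSelfAdjoint] at this
  cases isEmpty_or_nonempty m
  · simp [trExp, trace]
  have htr : 0 < A.trace := by
    rw [hA']
    exact Finset.sum_pos (fun i _ => hA.eigenvalues_pos i) Finset.univ_nonempty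
  rw [← Real.exp_log htr, ← trExp_add_smul_one hS]
  refine trExp_mono (hS.add (isHermitian_cfc _ _)) (hS.add (isHermitian_smul_one _)) ?_
  have h := posSemidef_cfc_sub_cfc hA.1 (f := Real.log) (g := fun _ => Real.log A.trace) ?_
  · rwa [cfc_const _ _ hA.1.isSelfAdjoint, Algebra.algebraMap_eq_smul_one,
      ← add_sub_add_left_eq_sub _ _ S] at h
  · intro i
    refine Real.log_le_log (hA.eigenvalues_pos i) ?_
    rw [hA']
    exact Finset.single_le_sum (f := hA.1.eigenvalues)
        (fun i _ => (hA.eigenvalues_pos i).le) (Finset.mem_univ i)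

/-- Uses `log x ≤ x - 1`. The logarithm of a mean is thereby replaced by an expression linear in
that mean. -/
theorem trExp_add_log_le_trExp_add_sub_one {S A : Matrix m m ℝ} (hS : S.IsHermitian)
    (hA : A.PosDef) : trExp (S + cfc Real.log A) ≤ trExp (S + (A - 1)) := by
  refine trExp_mono (hS.add (isHermitian_cfc _ _)) (hS.add (hA.1.sub isHermitian_one)) ?_
  have h := posSemidef_cfc_sub_cfc hA.1 (f := Real.log) (g := fun x => x - 1)
    fun i => Real.log_le_sub_one_of_pos (hA.eigenvalues_pos i)
  rwa [cfc_sub (fun x => x) (fun _ => 1) A (continuousOn_spectrum _ _) (continuousOn_spectrum _ _),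
    cfc_id' ℝ A hA.1.isSelfAdjoint, cfc_const_one ℝ A hA.1.isSelfAdjoint,
    ← add_sub_add_left_eq_sub _ _ S] at h

/-- Jensen's inequality is applied on a closed convex set. The positive definite cone is not closed,
which is why a fixed lower bound `1/2` is carried along. -/
theorem isClosed_setOf_sub_posSemidef (B : Matrix m m ℝ) :
    IsClosed {A : Matrix m m ℝ | (A - B).PosSemidef} := by
  simp only [posSemidef_iff_dotProduct_mulVec, Set.ofPred_and, Set.ofPred_forall, IsHermitian]
  refine (isClosed_eq (by fun_prop) (by fun_prop)).inter (isClosed_iInter fun x => ?_)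
  exact isClosed_le continuous_const (by fun_prop)

theorem convex_setOf_sub_posSemidef (B : Matrix m m ℝ) :
    Convex ℝ {A : Matrix m m ℝ | (A - B).PosSemidef} := by
  intro A₁ h₁ A₂ h₂ p q hp hq hpq
  have h : p • A₁ + q • A₂ - B = p • (A₁ - B) + q • (A₂ - B) := by
    conv_lhs => rw [← one_smul ℝ B, ← hpq]
    module
  rw [Set.mem_ofPred_eq, h]
  exact (PosSemidef.smul h₁ hp).add (PosSemidef.smul h₂ hq)

theorem posDef_of_sub_posSemidef {A : Matrix m m ℝ}
    (hA : (A - (1 / 2 : ℝ) • (1 : Matrix m m ℝ)).PosSemidef) : A.PosDef := by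
  have := (PosDef.one (n := m) (R := ℝ)).smul (show (0 : ℝ) < 1 / 2 by norm_num)
  simpa using PosDef.posSemidef_add hA this

variable {Ω : Type*} [MeasurableSpace Ω] {μ : Measure Ω}

open scoped Matrix.Norms.L2Operator in
theorem integrable_matrix {A : Ω → Matrix m m ℝ} (hA : ∀ i j, Integrable (fun ω => A ω i j) μ) :
    Integrable A μ := by
  have h : A = fun ω => ∑ i, ∑ j, A ω i j • single i j (1 : ℝ) := by
    ext ω : 1
    conv_lhs => rw [matrix_eq_sum_single (A ω)]
    simp
  rw [h]
  exact integrable_finsetSum _ fun i _ => integrable_finsetSum _ fun j _ => (hA i j).smul_const _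

open scoped Matrix.Norms.L2Operator in
theorem integral_matrix {A : Ω → Matrix m m ℝ} (hA : ∀ i j, Integrable (fun ω => A ω i j) μ) :
    ∫ ω, A ω ∂μ = Matrix.of fun i j => ∫ ω, A ω i j ∂μ := by
  have h : A = fun ω => ∑ i, ∑ j, A ω i j • single i j (1 : ℝ) := by
    ext ω : 1
    conv_lhs => rw [matrix_eq_sum_single (A ω)]
    simp
  conv_lhs => rw [h]
  rw [integral_finsetSum _ fun i _ => integrable_finsetSum _ fun j _ => (hA i j).smul_const _]
  simp_rw [integral_finsetSum _ fun j _ => (hA _ j).smul_const _, integral_smul_const]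
  conv_rhs => rw [matrix_eq_sum_single (Matrix.of fun i j => ∫ ω, A ω i j ∂μ)]
  simp

open scoped Matrix.Norms.L2Operator in
/-- Consequence of Lieb's theorem and Jensen's inequality. -/
theorem integral_trExp_add_log_le [IsProbabilityMeasure μ] {S : Matrix m m ℝ} (hS : S.IsHermitian)
    {A : Ω → Matrix m m ℝ} (hAint : ∀ i j, Integrable (fun ω => A ω i j) μ)
    (hA : ∀ ω, (A ω - (1 / 2 : ℝ) • (1 : Matrix m m ℝ)).PosSemidef) :
    Integrable (fun ω => trExp (S + cfc Real.log (A ω))) μ ∧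
    ∫ ω, trExp (S + cfc Real.log (A ω)) ∂μ
      ≤ trExp (S + ((Matrix.of fun i j => ∫ ω, A ω i j ∂μ) - 1)) := by
  classical
  set s : Set (Matrix m m ℝ) := {A | (A - (1 / 2 : ℝ) • (1 : Matrix m m ℝ)).PosSemidef}
  have hs : s ⊆ {A | A.PosDef} := fun A hA => posDef_of_sub_posSemidef hA
  have hscl : IsClosed s := isClosed_setOf_sub_posSemidef _
  have hconc : ConcaveOn ℝ s fun A => trExp (S + cfc Real.log A) :=
    (concaveOn_trExp_add_log hS).subset hs (convex_setOf_sub_posSemidef _)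
  have hcont : ContinuousOn (fun A => trExp (S + cfc Real.log A)) s := by
    rw [continuousOn_iff_continuous_domRestrict]
    refine continuous_trExp (K := fun A : s => S + cfc Real.log (A : Matrix m m ℝ)) ?_
      fun A => hS.add (isHermitian_cfc _ _)
    have := continuousOn_iff_continuous_domRestrict.1 ((continuousOn_cfc_log (m := m)).mono hs)
    exact continuous_const.add this
  have hi := integrable_matrix hAint
  have hgi : Integrable (fun ω => trExp (S + cfc Real.log (A ω))) μ := by
    have hb : Integrable (fun ω => (A ω).trace * trExp S) μ :=
      (integrable_finsetSum _ fun i _ => hAint i i).mul_const _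
    refine hb.mono' ?_ (ae_of_all _ fun ω => ?_)
    · have h1 : AEMeasurable A μ := hi.aestronglyMeasurable.aemeasurable
      -- Continuity is available only on `s`, so the function is extended by zero; `A` never leaves
      -- `s`.
      have h2 := hcont.measurable_piecewise (continuousOn_const (c := (0 : ℝ)))
        hscl.measurableSet
      refine ((h2.comp_aemeasurable h1).congr (ae_of_all _ fun ω => ?_)).aestronglyMeasurable
      exact Set.piecewise_eq_of_mem _ _ _ (show A ω ∈ s from hA ω)
    · rw [Real.norm_of_nonneg (trExp_nonneg (hS.add (isHermitian_cfc _ _)))]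
      exact trExp_add_log_le hS (hs (hA ω))
  refine ⟨hgi, (hconc.le_map_integral hcont hscl (ae_of_all _ hA) hi hgi).trans ?_⟩
  have hmem : ∫ ω, A ω ∂μ ∈ s :=
    (convex_setOf_sub_posSemidef _).integral_mem hscl (ae_of_all _ hA) hi
  rw [integral_matrix hAint] at hmem ⊢
  exact trExp_add_log_le_trExp_add_sub_one hS (hs hmem)

/-- Stated with the Lebesgue integral in `[0, ∞]`, so that neither measurability nor integrability
of the term containing `Y` has to be known. -/
theorem lintegral_trExp_add_le [IsProbabilityMeasure μ] {S : Matrix m m ℝ} (hS : S.IsHermitian)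
    {Y A : Ω → Matrix m m ℝ} (hY : ∀ ω, (Y ω).IsHermitian)
    (hAint : ∀ i j, Integrable (fun ω => A ω i j) μ)
    (hA : ∀ ω, (A ω - (1 / 2 : ℝ) • (1 : Matrix m m ℝ)).PosSemidef)
    (hYA : ∀ ω, (cfc Real.log (A ω) - Y ω).PosSemidef) :
    ∫⁻ ω, ENNReal.ofReal (trExp (S + Y ω)) ∂μ
      ≤ ENNReal.ofReal (trExp (S + ((Matrix.of fun i j => ∫ ω, A ω i j ∂μ) - 1))) := by
  obtain ⟨hi, hle⟩ := integral_trExp_add_log_le hS hAint hA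
  calc ∫⁻ ω, ENNReal.ofReal (trExp (S + Y ω)) ∂μ
      ≤ ∫⁻ ω, ENNReal.ofReal (trExp (S + cfc Real.log (A ω))) ∂μ := by
        refine lintegral_mono fun ω => ENNReal.ofReal_le_ofReal ?_
        refine trExp_mono (hS.add (hY ω)) (hS.add (isHermitian_cfc _ _)) ?_
        rw [add_sub_add_left_eq_sub]
        exact hYA ω
    _ = ENNReal.ofReal (∫ ω, trExp (S + cfc Real.log (A ω)) ∂μ) :=
        (ofReal_integral_eq_lintegral_ofReal hi
          (ae_of_all _ fun ω => trExp_nonneg (hS.add (isHermitian_cfc _ _)))).symm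
    _ ≤ _ := ENNReal.ofReal_le_ofReal hle

/-- Subadditivity of matrix cumulant generating functions, iterated over independent summands. -/
theorem lintegral_trExp_sum_le [IsProbabilityMeasure μ] {ι : Type*} {Y : ι → Ω → Matrix m m ℝ}
    (hYm : ∀ i, Measurable (Y i)) (hY : ∀ i ω, (Y i ω).IsHermitian) (hind : iIndepFun Y μ)
    {C : ι → Matrix m m ℝ} (hC : ∀ i, (C i).IsHermitian)
    (hstep : ∀ i, ∀ S : Matrix m m ℝ, S.IsHermitian →
      ∫⁻ ω, ENNReal.ofReal (trExp (S + Y i ω)) ∂μ ≤ ENNReal.ofReal (trExp (S + C i)))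
    (s : Finset ι) : ∀ K : Matrix m m ℝ, K.IsHermitian →
      ∫⁻ ω, ENNReal.ofReal (trExp (K + ∑ i ∈ s, Y i ω)) ∂μ
        ≤ ENNReal.ofReal (trExp (K + ∑ i ∈ s, C i)) := by
  classical
  induction s using Finset.induction_on with
  | empty => intro K _; simp
  | insert i s his ih =>
    intro K hK
    have hsum : ∀ ω, (∑ j ∈ s, Y j ω).IsHermitian := fun ω => by
      rw [IsHermitian, conjTranspose_sum]
      exact Finset.sum_congr rfl fun j _ => hY j ω
    have hI : IndepFun (∑ j ∈ s, Y j) (Y i) μ := hind.indepFun_finsetSum_of_notMem hYm his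
    have hsm : Measurable (∑ j ∈ s, Y j) := by
      simpa only [Finset.sum_fn] using Finset.measurable_sum s fun j _ => hYm j
    set h : Matrix m m ℝ × Matrix m m ℝ → ENNReal := fun p =>
      ENNReal.ofReal (trExp ((1 / 2 : ℝ) • ((K + p.1 + p.2) + (K + p.1 + p.2)ᵀ))) with hh
    have hhm : Measurable h := by
      have : Continuous fun p : Matrix m m ℝ × Matrix m m ℝ => K + p.1 + p.2 := by fun_prop
      exact ENNReal.measurable_ofReal.comp
        (continuous_trExp_half_add_transpose.comp this).measurable
    have hmap := (indepFun_iff_map_prod_eq_prod_map_map hsm.aemeasurable (hYm i).aemeasurable).1 hI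
    calc ∫⁻ ω, ENNReal.ofReal (trExp (K + ∑ j ∈ insert i s, Y j ω)) ∂μ
        = ∫⁻ ω, h ((∑ j ∈ s, Y j) ω, Y i ω) ∂μ := by
          refine lintegral_congr fun ω => ?_
          simp only [hh, Finset.sum_apply]
          rw [half_add_transpose_eq ((hK.add (hsum ω)).add (hY i ω)), Finset.sum_insert his,
            add_assoc K, add_comm (Y i ω)]
      _ = ∫⁻ p, h p ∂(μ.map (∑ j ∈ s, Y j)).prod (μ.map (Y i)) := by
          rw [← hmap, lintegral_map hhm (hsm.prodMk (hYm i))]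
      _ = ∫⁻ ω, ∫⁻ ω', h ((∑ j ∈ s, Y j) ω, Y i ω') ∂μ ∂μ := by
          have := Measure.isProbabilityMeasure_map (μ := μ) (hYm i).aemeasurable
          rw [lintegral_prod _ hhm.aemeasurable, lintegral_map hhm.lintegral_prod_right' hsm]
          refine lintegral_congr fun ω => ?_
          exact lintegral_map (hhm.comp measurable_prodMk_left) (hYm i)
      _ ≤ ∫⁻ ω, ENNReal.ofReal (trExp ((K + C i) + ∑ j ∈ s, Y j ω)) ∂μ := by
          refine lintegral_mono fun ω => ?_
          -- After Fubini the other summands are frozen and play the role of the deterministic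
          -- matrix `S`. The bound `C i` then joins `K` for the induction hypothesis.
          have h1 := hstep i (K + ∑ j ∈ s, Y j ω) (hK.add (hsum ω))
          rw [add_right_comm] at h1
          refine le_trans (le_of_eq ?_) h1
          refine lintegral_congr fun ω' => ?_
          simp only [hh, Finset.sum_apply]
          rw [half_add_transpose_eq ((hK.add (hsum ω)).add (hY i ω'))]
      _ ≤ _ := by
          refine (ih (K + C i) (hK.add (hC i))).trans (le_of_eq ?_)
          rw [Finset.sum_insert his, add_assoc]

end Jensen

end LowPopArt

namespace LowPopArt

/-! ### Singular values under perturbation. -/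

section SingularValues

open Module

variable {E F : Type*} [NormedAddCommGroup E] [InnerProductSpace ℝ E] [FiniteDimensional ℝ E]
  [NormedAddCommGroup F] [InnerProductSpace ℝ F] [FiniteDimensional ℝ F]

/-- Right singular vectors: an orthonormal eigenbasis of `Tᵀ T`. -/
noncomputable def rightSingular (T : E →ₗ[ℝ] F) : OrthonormalBasis (Fin (finrank ℝ E)) ℝ E :=
  T.isSymmetric_adjoint_comp_self.eigenvectorBasis rfl

theorem inner_map_rightSingular (T : E →ₗ[ℝ] F) (j k : Fin (finrank ℝ E)) :
    inner ℝ (T (rightSingular T j)) (T (rightSingular T k))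
      = if j = k then T.singularValues k ^ 2 else 0 := by
  have h := T.isSymmetric_adjoint_comp_self.apply_eigenvectorBasis rfl k
  rw [← LinearMap.adjoint_inner_right]
  change inner ℝ (rightSingular T j) ((LinearMap.adjoint T ∘ₗ T)
    (T.isSymmetric_adjoint_comp_self.eigenvectorBasis rfl k)) = _
  rw [h, inner_smul_right, T.sq_singularValues_fin rfl k]
  have := orthonormal_iff_ite.1 (rightSingular T).orthonormal j k
  rw [rightSingular] at this ⊢
  rw [this]
  simp

theorem norm_sq_map_sum_rightSingular (T : E →ₗ[ℝ] F) (c : Fin (finrank ℝ E) → ℝ) :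
    ‖T (∑ k, c k • rightSingular T k)‖ ^ 2 =
      ∑ k : Fin (finrank ℝ E), T.singularValues k ^ 2 * c k ^ 2 := by
  rw [← real_inner_self_eq_norm_sq, map_sum, sum_inner]
  refine Finset.sum_congr rfl fun j _ => ?_
  rw [inner_sum]
  simp only [map_smul, real_inner_smul_left, real_inner_smul_right, inner_map_rightSingular]
  simp
  ring

theorem norm_sq_sum_rightSingular (T : E →ₗ[ℝ] F) (c : Fin (finrank ℝ E) → ℝ) :
    ‖∑ k, c k • rightSingular T k‖ ^ 2 = ∑ k, c k ^ 2 := by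
  rw [← real_inner_self_eq_norm_sq, (rightSingular T).orthonormal.inner_sum]
  simp [sq]

theorem norm_map_rightSingular (T : E →ₗ[ℝ] F) (k : Fin (finrank ℝ E)) :
    ‖T (rightSingular T k)‖ = T.singularValues k := by
  have h := inner_map_rightSingular T k k
  rw [if_pos rfl, real_inner_self_eq_norm_sq] at h
  exact (sq_eq_sq₀ (norm_nonneg _) (T.singularValues_nonneg _)).1 h

theorem singularValues_le_of_bound {T : E →ₗ[ℝ] F} {τ : ℝ} (hτ : 0 ≤ τ)
    (hT : ∀ x, ‖T x‖ ≤ τ * ‖x‖) (k : ℕ) : T.singularValues k ≤ τ := by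
  by_cases hk : k < finrank ℝ E
  · have := hT (rightSingular T ⟨k, hk⟩)
    rwa [norm_map_rightSingular, OrthonormalBasis.norm_eq_one, mul_one] at this
  · rw [T.singularValues_of_finrank_le (not_lt.1 hk)]
    exact hτ

theorem sum_norm_sq_map_eq_trace {ι : Type*} [Fintype ι] (T : E →ₗ[ℝ] F)
    (b : OrthonormalBasis ι ℝ E) :
    ∑ i, ‖T (b i)‖ ^ 2 = LinearMap.trace ℝ E (LinearMap.adjoint T ∘ₗ T) := by
  rw [LinearMap.trace_eq_sum_inner _ b]
  refine Finset.sum_congr rfl fun i _ => ?_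
  rw [LinearMap.comp_apply, LinearMap.adjoint_inner_right, real_inner_self_eq_norm_sq]

theorem sum_sq_singularValues {ι : Type*} [Fintype ι] (T : E →ₗ[ℝ] F)
    (b : OrthonormalBasis ι ℝ E) :
    ∑ k : Fin (finrank ℝ E), T.singularValues k ^ 2 = ∑ i, ‖T (b i)‖ ^ 2 := by
  rw [sum_norm_sq_map_eq_trace, ← sum_norm_sq_map_eq_trace T (rightSingular T)]
  simp only [norm_map_rightSingular]

/-- At most `r` singular values are nonzero and each is at most `τ`. The exponents `1` and `2` serve
the nuclear and Frobenius norms. -/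
theorem sum_range_singularValues_le {T : E →ₗ[ℝ] F} {τ : ℝ} {r : ℕ} (hr : finrank ℝ T.range ≤ r)
    (hτ : 0 ≤ τ) (hT : ∀ x, ‖T x‖ ≤ τ * ‖x‖) {p : ℕ} (hp : p ≠ 0) (N : ℕ) :
    ∑ k ∈ Finset.range N, T.singularValues k ^ p ≤ r * τ ^ p := by
  have h1 : ∀ k, T.singularValues k ^ p ≤ if k < r then τ ^ p else 0 := by
    intro k
    split_ifs with hk
    · exact pow_le_pow_left₀ (T.singularValues_nonneg k) (singularValues_le_of_bound hτ hT k) p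
    · rw [T.singularValues_eq_zero_iff_le_finrank_range.2 (hr.trans (not_lt.1 hk)), zero_pow hp]
  refine (Finset.sum_le_sum fun k _ => h1 k).trans ?_
  rw [← Finset.sum_filter, Finset.sum_const, nsmul_eq_mul]
  refine mul_le_mul_of_nonneg_right ?_ (pow_nonneg hτ p)
  have : (Finset.range N).filter (· < r) ⊆ Finset.range r := fun k hk => by
    simpa using (Finset.mem_filter.1 hk).2
  exact_mod_cast (Finset.card_le_card this).trans (Finset.card_range r).le

/-- Singular values of a perturbation of a map of rank at most `r`: at most `r` of them exceed the
size of the perturbation. -/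
theorem card_singularValues_gt_le {T S : E →ₗ[ℝ] F} {τ : ℝ} {r : ℕ} (hτ : 0 ≤ τ)
    (hTS : ∀ x, ‖(T - S) x‖ ≤ τ * ‖x‖) (hr : finrank ℝ S.range ≤ r) :
    (Finset.univ.filter fun k : Fin (finrank ℝ E) => ¬ T.singularValues k ≤ τ).card ≤ r := by
  set I := Finset.univ.filter fun k : Fin (finrank ℝ E) => ¬ T.singularValues k ≤ τ with hI
  by_contra! hlt
  let L : (I → ℝ) →ₗ[ℝ] E := Fintype.linearCombination ℝ fun k : I => rightSingular T k
  -- More than `r` singular directions cannot be mapped injectively by `S`. On a combination killed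
  -- by `S`, `T` equals `T - S` and stretches by at most `τ`, whereas every direction used is
  -- stretched by more than `τ`.
  have hker : LinearMap.ker (S ∘ₗ L) ≠ ⊥ := by
    intro h0
    have h1 := (S ∘ₗ L).finrank_range_add_finrank_ker
    rw [h0, finrank_bot, add_zero, finrank_fintype_fun_eq_card, Fintype.card_coe] at h1
    have h2 : finrank ℝ (S ∘ₗ L).range ≤ finrank ℝ S.range :=
      Submodule.finrank_mono (LinearMap.range_comp_le_range L S)
    omega
  obtain ⟨c, hc, hc0⟩ := Submodule.exists_mem_ne_zero_of_ne_bot hker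
  set d : Fin (finrank ℝ E) → ℝ := fun k => if h : k ∈ I then c ⟨k, h⟩ else 0 with hd
  have hL : L c = ∑ k, d k • rightSingular T k := by
    rw [Fintype.linearCombination_apply, ← Finset.sum_subset (Finset.subset_univ I),
      ← Finset.sum_coe_sort I]
    · exact Finset.sum_congr rfl fun k _ => by simp [hd]
    · intro k _ hk
      simp [hd, hk]
  have h1 := hTS (L c)
  have h2 : S (L c) = 0 := hc
  rw [LinearMap.sub_apply, h2, sub_zero] at h1
  have h3 := pow_le_pow_left₀ (norm_nonneg _) h1 2
  rw [mul_pow, hL, norm_sq_map_sum_rightSingular, norm_sq_sum_rightSingular, Finset.mul_sum] at h3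
  refine h3.not_gt (Finset.sum_lt_sum (fun k _ => ?_) ?_)
  · by_cases hk : k ∈ I
    · have := (not_le.1 (Finset.mem_filter.1 hk).2).le
      exact mul_le_mul_of_nonneg_right (pow_le_pow_left₀ hτ this 2) (sq_nonneg _)
    · simp [hd, hk]
  · obtain ⟨⟨k, hk⟩, hck⟩ := Function.ne_iff.1 hc0
    refine ⟨k, Finset.mem_univ _, ?_⟩
    have h4 : d k = c ⟨k, hk⟩ := by simp [hd, hk]
    have h5 : 0 < d k ^ 2 := by
      rw [h4]
      exact sq_pos_of_ne_zero hck
    exact mul_lt_mul_of_pos_right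
      (pow_lt_pow_left₀ (not_le.1 (Finset.mem_filter.1 hk).2) hτ two_ne_zero) h5

end SingularValues

/-! ### Deterministic analysis of singular value hard thresholding. -/

section Threshold

open Module

variable {d₁ d₂ : ℕ}

theorem finrank_range_toEuclideanLin (M : Matrix (Fin d₁) (Fin d₂) ℝ) :
    finrank ℝ (toEuclideanLin M).range = M.rank := by
  rw [rank_eq_finrank_range_toLin M (EuclideanSpace.basisFun (Fin d₁) ℝ).toBasis
    (EuclideanSpace.basisFun (Fin d₂) ℝ).toBasis, toEuclideanLin_eq_toLin_orthonormal]

theorem frobNorm_sq (M : Matrix (Fin d₁) (Fin d₂) ℝ) :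
    frobNorm M = √(∑ k ∈ Finset.range d₂, (toEuclideanLin M).singularValues k ^ 2) := by
  have h := sum_sq_singularValues (toEuclideanLin M) (EuclideanSpace.basisFun (Fin d₂) ℝ)
  rw [Fin.sum_univ_eq_sum_range (fun k => (toEuclideanLin M).singularValues k ^ 2),
    finrank_euclideanSpace_fin] at h
  rw [frobNorm, h, Finset.sum_comm]
  congr 1
  refine Finset.sum_congr rfl fun j _ => ?_
  rw [EuclideanSpace.norm_sq_eq]
  simp [toLpLin_apply]

theorem nuclearNorm_frobNorm_le {M : Matrix (Fin d₁) (Fin d₂) ℝ} {τ : ℝ} {r : ℕ}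
    (hr : finrank ℝ (toEuclideanLin M).range ≤ r)
    (hτ : 0 ≤ τ) (hM : ∀ x, ‖toEuclideanLin M x‖ ≤ τ * ‖x‖) :
    nuclearNorm M ≤ r * τ ∧ frobNorm M ≤ √r * τ := by
  constructor
  · simpa [nuclearNorm] using sum_range_singularValues_le hr hτ hM one_ne_zero d₂
  · rw [frobNorm_sq]
    refine (Real.sqrt_le_sqrt (sum_range_singularValues_le hr hτ hM two_ne_zero d₂)).trans ?_
    rw [Real.sqrt_mul (Nat.cast_nonneg r), Real.sqrt_sq hτ]

theorem toEuclideanLin_hardThreshold (τ : ℝ) (M : Matrix (Fin d₁) (Fin d₂) ℝ)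
    (x : EuclideanSpace ℝ (Fin d₂)) :
    toEuclideanLin (hardThreshold τ M) x =
      ∑ k : Fin (finrank ℝ (EuclideanSpace ℝ (Fin d₂))),
      if (toEuclideanLin M).singularValues k ≤ τ then 0
      else inner ℝ (rightSingular (toEuclideanLin M) k) x •
        toEuclideanLin M (rightSingular (toEuclideanLin M) k) := by
  rw [hardThreshold, map_sum, LinearMap.sum_apply]
  refine Finset.sum_congr rfl fun k _ => ?_
  split_ifs
  · simp
  · ext i
    simp only [toLpLin_apply, vecMulVec_mulVec, rightSingular]
    simp [EuclideanSpace.inner_eq_star_dotProduct, dotProduct_comm, mul_comm]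

/-- In the right singular basis the difference is, up to sign, `M` restricted to the directions
whose singular value is at most `τ`, and the images of the basis vectors are orthogonal. -/
theorem norm_toEuclideanLin_hardThreshold_sub_le {τ : ℝ} (hτ : 0 ≤ τ)
    (M : Matrix (Fin d₁) (Fin d₂) ℝ) (x : EuclideanSpace ℝ (Fin d₂)) :
    ‖toEuclideanLin (hardThreshold τ M - M) x‖ ≤ τ * ‖x‖ := by
  set T := toEuclideanLin M with hT
  have hx : x = ∑ k, inner ℝ (rightSingular T k) x • rightSingular T k :=
    ((rightSingular T).sum_repr' x).symm
  have h1 : toEuclideanLin (hardThreshold τ M - M) x =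
      - T (∑ k : Fin (finrank ℝ (EuclideanSpace ℝ (Fin d₂))),
      (if T.singularValues k ≤ τ then inner ℝ (rightSingular T k) x else 0) •
        rightSingular T k) := by
    rw [map_sub, LinearMap.sub_apply, toEuclideanLin_hardThreshold, ← hT]
    conv_lhs => rw [show T x = T (∑ k, inner ℝ (rightSingular T k) x • rightSingular T k) by
      rw [← hx]]
    rw [map_sum, map_sum, ← Finset.sum_sub_distrib, ← Finset.sum_neg_distrib]
    refine Finset.sum_congr rfl fun k _ => ?_
    split_ifs <;> simp
  have h2 : ‖x‖ ^ 2 = ∑ k, inner ℝ (rightSingular T k) x ^ 2 := by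
    conv_lhs => rw [hx]
    exact norm_sq_sum_rightSingular T _
  refine le_of_sq_le_sq ?_ (by positivity)
  rw [h1, norm_neg, norm_sq_map_sum_rightSingular, mul_pow, h2, Finset.mul_sum]
  refine Finset.sum_le_sum fun k _ => ?_
  split_ifs with hk
  · exact mul_le_mul_of_nonneg_right (pow_le_pow_left₀ (T.singularValues_nonneg _) hk 2)
      (sq_nonneg _)
  · simp only [ne_eq, OfNat.ofNat_ne_zero, not_false_eq_true, zero_pow, mul_zero]
    positivity

theorem finrank_range_hardThreshold_le {τ : ℝ} {r : ℕ} (hτ : 0 ≤ τ)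
    {M Θ : Matrix (Fin d₁) (Fin d₂) ℝ}
    (hM : ∀ x, ‖toEuclideanLin (M - Θ) x‖ ≤ τ * ‖x‖) (hr : Θ.rank ≤ r) :
    finrank ℝ (toEuclideanLin (hardThreshold τ M)).range ≤ r := by
  classical
  set T := toEuclideanLin M with hT
  have hcard := card_singularValues_gt_le (r := r) (T := T) (S := toEuclideanLin Θ) hτ
    (fun x => by rw [hT, ← map_sub]; exact hM x) (by rwa [finrank_range_toEuclideanLin])
  set I := Finset.univ.filter fun k : Fin (finrank ℝ (EuclideanSpace ℝ (Fin d₂))) =>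
    ¬ T.singularValues k ≤ τ with hI
  have hle : (toEuclideanLin (hardThreshold τ M)).range
      ≤ Submodule.span ℝ ((I.image fun k => T (rightSingular T k) : Finset _) : Set _) := by
    rintro _ ⟨x, rfl⟩
    rw [toEuclideanLin_hardThreshold]
    refine Submodule.sum_mem _ fun k _ => ?_
    split_ifs with hk
    · exact Submodule.zero_mem _
    · refine Submodule.smul_mem _ _ (Submodule.subset_span ?_)
      exact Finset.mem_coe.2 (Finset.mem_image_of_mem _ (Finset.mem_filter.2 ⟨Finset.mem_univ _, hk⟩))
  exact (Submodule.finrank_mono hle).trans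
    ((finrank_span_finset_le_card _).trans (Finset.card_image_le.trans hcard))

/-- Error bounds for singular value hard thresholding of a matrix close, in operator norm, to a
matrix of rank at most `r`. -/
theorem hardThreshold_error_le {τ : ℝ} {r : ℕ} (hτ : 0 ≤ τ)
    {M Θ : Matrix (Fin d₁) (Fin d₂) ℝ}
    (hM : ∀ x, ‖toEuclideanLin (M - Θ) x‖ ≤ τ * ‖x‖) (hr : Θ.rank ≤ r) :
    nuclearNorm (hardThreshold τ M - Θ) ≤ 2 * r * (2 * τ) ∧
      frobNorm (hardThreshold τ M - Θ) ≤ √(2 * r) * (2 * τ) := by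
  have h1 : finrank ℝ (toEuclideanLin (hardThreshold τ M - Θ)).range ≤ 2 * r := by
    have h2 : (toEuclideanLin (hardThreshold τ M - Θ)).range
        ≤ (toEuclideanLin (hardThreshold τ M)).range ⊔ (toEuclideanLin Θ).range := by
      rintro _ ⟨x, rfl⟩
      rw [map_sub, LinearMap.sub_apply]
      exact Submodule.sub_mem _ (Submodule.mem_sup_left ⟨x, rfl⟩)
        (Submodule.mem_sup_right ⟨x, rfl⟩)
    have h3 := Submodule.finrank_mono h2
    have h4 := Submodule.finrank_add_le_finrank_add_finrank
      (toEuclideanLin (hardThreshold τ M)).range (toEuclideanLin Θ).range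
    have h5 := finrank_range_hardThreshold_le hτ hM hr
    have h6 := finrank_range_toEuclideanLin Θ
    omega
  -- One `τ` comes from the removed singular values, the other from the distance of `M` to `Θ`.
  have h2 : ∀ x, ‖toEuclideanLin (hardThreshold τ M - Θ) x‖ ≤ 2 * τ * ‖x‖ := fun x => by
    have e : hardThreshold τ M - Θ = (hardThreshold τ M - M) + (M - Θ) := by abel
    rw [e, map_add, LinearMap.add_apply]
    have := norm_toEuclideanLin_hardThreshold_sub_le hτ M x
    linarith [norm_add_le (toEuclideanLin (hardThreshold τ M - M) x) (toEuclideanLin (M - Θ) x),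
      hM x]
  simpa using nuclearNorm_frobNorm_le h1 (by positivity) h2

end Threshold

end LowPopArt

namespace LowPopArt

/-! ### Odd influence functions and dilations. -/

section OddPart

variable {d₁ d₂ : ℕ}

/-- Odd part of a function. -/
noncomputable def oddPart (φ : ℝ → ℝ) (x : ℝ) : ℝ := (1 / 2) * (φ x - φ (-x))

/-- The two envelopes are exchanged, up to sign, by `x ↦ -x`, so `-φ(-x)` obeys the same bounds as
`φ(x)`, and hence so does the average. -/
theorem IsInfluence.oddPart {φ : ℝ → ℝ} (hφ : IsInfluence φ) : IsInfluence (oddPart φ) where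
  continuous := by
    have := hφ.continuous
    unfold LowPopArt.oddPart
    fun_prop
  lower x := by
    have h1 := hφ.lower x
    have h2 := hφ.upper (-x)
    rw [neg_sq, ← sub_eq_add_neg] at h2
    unfold LowPopArt.oddPart
    linarith
  upper x := by
    have h1 := hφ.upper x
    have h2 := hφ.lower (-x)
    rw [neg_sq, sub_neg_eq_add] at h2
    unfold LowPopArt.oddPart
    linarith

theorem isHermitian_dilation (M : Matrix (Fin d₁) (Fin d₂) ℝ) : (dilation M).IsHermitian := by
  rw [IsHermitian, conjTranspose_eq_transpose_of_trivial, dilation, fromBlocks_transpose]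
  simp

/-- The grading involution `diag(I, -I)`. -/
def gradingSign : Matrix (Fin d₁ ⊕ Fin d₂) (Fin d₁ ⊕ Fin d₂) ℝ := fromBlocks 1 0 0 (-1)

theorem gradingSign_mul_self :
    (gradingSign * gradingSign : Matrix (Fin d₁ ⊕ Fin d₂) (Fin d₁ ⊕ Fin d₂) ℝ) = 1 := by
  simp [gradingSign, fromBlocks_multiply]

theorem star_gradingSign : star (gradingSign (d₁ := d₁) (d₂ := d₂)) = gradingSign := by
  rw [star_eq_conjTranspose, conjTranspose_eq_transpose_of_trivial, gradingSign,
    fromBlocks_transpose]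
  simp

/-- The grading anticommutes with dilations, so conjugation by it sends a dilation to its negative,
and the functional calculus commutes with unitary conjugation. -/
theorem cfc_neg_dilation (f : ℝ → ℝ) (M : Matrix (Fin d₁) (Fin d₂) ℝ) :
    cfc f (-dilation M) = gradingSign * cfc f (dilation M) * gradingSign := by
  have hu : gradingSign (d₁ := d₁) (d₂ := d₂) ∈
      unitary (Matrix (Fin d₁ ⊕ Fin d₂) (Fin d₁ ⊕ Fin d₂) ℝ) :=
    Unitary.mem_iff.2 ⟨by rw [star_gradingSign, gradingSign_mul_self],
      by rw [star_gradingSign, gradingSign_mul_self]⟩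
  have h := StarAlgHomClass.map_cfc (S := ℝ)
    (Unitary.conjStarAlgAut ℝ _ (⟨gradingSign, hu⟩ : unitary _)) f (dilation M)
    (continuousOn_spectrum _ _)
    (by
      change Continuous fun A => gradingSign * A * star gradingSign
      fun_prop)
    (isHermitian_dilation M).isSelfAdjoint ((isHermitian_dilation M).isSelfAdjoint.map _)
  simp only [Unitary.conjStarAlgAut_apply, star_gradingSign] at h
  rw [h]
  congr 1
  simp [gradingSign, dilation, fromBlocks_multiply, fromBlocks_neg]

/-- The odd part of `φ` picks the off-diagonal blocks of `φ` of a dilation. -/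
theorem cfc_oddPart_dilation (φ : ℝ → ℝ) (M : Matrix (Fin d₁) (Fin d₂) ℝ) :
    cfc (oddPart φ) (dilation M) = fromBlocks 0 (cfc φ (dilation M)).toBlocks₁₂
      (cfc φ (dilation M)).toBlocks₂₁ 0 := by
  have h1 : cfc (oddPart φ) (dilation M)
      = (1 / 2 : ℝ) • (cfc φ (dilation M) - cfc φ (-dilation M)) := by
    rw [← cfc_comp_neg φ (dilation M)
      ((Matrix.finite_real_spectrum (A := dilation M)).image _ |>.continuousOn _)
      (isHermitian_dilation M).isSelfAdjoint,
      ← cfc_sub φ (fun x => φ (-x)) _ (continuousOn_spectrum _ _) (continuousOn_spectrum _ _),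
      ← cfc_const_mul (1 / 2 : ℝ) _ _ (continuousOn_spectrum _ _)]
    rfl
  rw [h1, cfc_neg_dilation]
  conv_lhs => rw [← fromBlocks_toBlocks (cfc φ (dilation M))]
  simp only [gradingSign, fromBlocks_multiply, sub_eq_add_neg, fromBlocks_neg, fromBlocks_add,
    fromBlocks_smul]
  simp [← two_smul ℝ, smul_smul]

end OddPart

/-! ### Loewner bounds for influence functions and the largest eigenvalue. -/

section Influence

variable {m : Type*} [Fintype m] [DecidableEq m]

theorem cfc_quadratic {H : Matrix m m ℝ} (hH : H.IsHermitian) (c : ℝ) :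
    cfc (fun x => c + x + x ^ 2 / 2) H = c • (1 : Matrix m m ℝ) + H + (1 / 2 : ℝ) • (H * H) := by
  have h : (fun x : ℝ => c + x + x ^ 2 / 2) = fun x => (c + x) + (1 / 2) * (x * x) := by
    ext x; ring
  rw [h, cfc_add _ _ _ (continuousOn_spectrum _ _) (continuousOn_spectrum _ _),
    cfc_const_mul _ _ _ (continuousOn_spectrum _ _),
    cfc_mul _ _ _ (continuousOn_spectrum _ _) (continuousOn_spectrum _ _),
    cfc_const_add _ _ _ (continuousOn_spectrum _ _), cfc_id' ℝ H hH.isSelfAdjoint,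
    Algebra.algebraMap_eq_smul_one]

/-- The scalar identity is `1 + x + x²/2 = 1/2 + (1 + x)²/2`; this is where the constant `1/2`
originates. -/
theorem posSemidef_quadratic_sub_half {H : Matrix m m ℝ} (hH : H.IsHermitian) :
    ((1 + H + (1 / 2 : ℝ) • (H * H)) - (1 / 2 : ℝ) • (1 : Matrix m m ℝ)).PosSemidef := by
  have h := posSemidef_cfc_sub_cfc hH (f := fun _ => 1 / 2) (g := fun x => 1 + x + x ^ 2 / 2)
    fun i => by nlinarith [sq_nonneg (1 + hH.eigenvalues i)]
  rwa [cfc_quadratic hH, cfc_const _ _ hH.isSelfAdjoint, Algebra.algebraMap_eq_smul_one,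
    one_smul] at h

theorem IsInfluence.posSemidef_log_sub {φ : ℝ → ℝ} (hφ : IsInfluence φ) {H : Matrix m m ℝ}
    (hH : H.IsHermitian) :
    (cfc Real.log (1 + H + (1 / 2 : ℝ) • (H * H)) - cfc φ H).PosSemidef := by
  have h := posSemidef_cfc_sub_cfc hH (f := φ) (g := fun x => Real.log (1 + x + x ^ 2 / 2))
    fun i => hφ.upper _
  rwa [cfc_comp' Real.log (fun x => 1 + x + x ^ 2 / 2) H
    ((Matrix.finite_real_spectrum (A := H)).image _ |>.continuousOn _) (continuousOn_spectrum _ _)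
    hH.isSelfAdjoint, cfc_quadratic hH, one_smul] at h

theorem posSemidef_lambdaMax_sub {S : Matrix m m ℝ} (hS : S.IsHermitian) :
    (lambdaMax S • (1 : Matrix m m ℝ) - S).PosSemidef := by
  have h := posSemidef_cfc_sub_cfc hS (f := fun x => x) (g := fun _ => lambdaMax S) fun i =>
    le_csSup (Matrix.finite_real_spectrum (A := S)).bddAbove (hS.eigenvalues_mem_spectrum_real i)
  rwa [cfc_const _ _ hS.isSelfAdjoint, cfc_id' ℝ S hS.isSelfAdjoint,
      Algebra.algebraMap_eq_smul_one] at h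

theorem dotProduct_mulVec_le_lambdaMax {S : Matrix m m ℝ} (hS : S.IsHermitian) (x : m → ℝ) :
    x ⬝ᵥ (S *ᵥ x) ≤ lambdaMax S * (x ⬝ᵥ x) := by
  have := (posSemidef_lambdaMax_sub hS).dotProduct_mulVec_nonneg x
  rw [star_trivial, sub_mulVec, dotProduct_sub, smul_mulVec, one_mulVec, dotProduct_smul,
    smul_eq_mul] at this
  linarith

theorem lambdaMax_pos [Nonempty m] {S : Matrix m m ℝ} (hS : S.PosDef) : 0 < lambdaMax S :=
  (hS.eigenvalues_pos (Classical.arbitrary m)).trans_le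
    (le_csSup (Matrix.finite_real_spectrum (A := S)).bddAbove
      (hS.1.eigenvalues_mem_spectrum_real _))

end Influence

/-! ### Conditional moments of the noise and of the residual. -/

section Noise

variable {Ω E : Type*} [mΩ : MeasurableSpace Ω] [mE : MeasurableSpace E] {μ : Measure Ω}
  [IsProbabilityMeasure μ] {σ : ℝ} {X : Ω → E} {η : Ω → ℝ} {b : E → ℝ} {C : ℝ}

theorem integral_mul_condExp (hX : Measurable X) {g : Ω → ℝ} (hg : Integrable g μ)
    (hb : Measurable b) (hC : ∀ᵐ ω ∂μ, |b (X ω)| ≤ C) :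
    ∫ ω, b (X ω) * g ω ∂μ = ∫ ω, b (X ω) * (μ[g | mE.comap X]) ω ∂μ := by
  have hs : StronglyMeasurable[mE.comap X] (fun ω => b (X ω)) :=
    (hb.comp (comap_measurable X)).stronglyMeasurable
  have hi : Integrable (fun ω => b (X ω) * g ω) μ :=
    hg.bdd_mul (hb.comp hX).aestronglyMeasurable hC
  have h := condExp_mul_of_stronglyMeasurable_left hs hi hg
  rw [← integral_condExp hX.comap_le]
  exact integral_congr_ae h

theorem IsNoise.integral_mul_eq_zero (h : IsNoise μ σ X η) (hX : Measurable X)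
    (hb : Measurable b) (hC : ∀ᵐ ω ∂μ, |b (X ω)| ≤ C) : ∫ ω, b (X ω) * η ω ∂μ = 0 := by
  rw [integral_mul_condExp hX (h.memLp.integrable one_le_two) hb hC, ← integral_zero Ω ℝ]
  refine integral_congr_ae ?_
  filter_upwards [h.condMean] with ω hω
  rw [hω, Pi.zero_apply, mul_zero]

theorem IsNoise.integral_sq_mul_le (h : IsNoise μ σ X η) (hX : Measurable X)
    (hb : Measurable b) (hC : ∀ᵐ ω ∂μ, |b (X ω)| ≤ C) (hb0 : ∀ x, 0 ≤ b x) :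
    ∫ ω, b (X ω) * η ω ^ 2 ∂μ ≤ σ ^ 2 * ∫ ω, b (X ω) ∂μ := by
  rw [integral_mul_condExp hX h.memLp.integrable_sq hb hC, mul_comm, ← integral_mul_const]
  refine integral_mono_ae (integrable_condExp.bdd_mul (hb.comp hX).aestronglyMeasurable hC)
    ((Integrable.of_bound (hb.comp hX).aestronglyMeasurable C hC).mul_const _) ?_
  filter_upwards [h.condVar] with ω hω
  exact mul_le_mul_of_nonneg_left hω (hb0 _)

theorem IsNoise.integrable_mul_residual_sq (h : IsNoise μ σ X η) (hX : Measurable X) {D : E → ℝ} {R₀ : ℝ}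
    (hD : Measurable D) (hDR : ∀ᵐ ω ∂μ, |D (X ω)| ≤ R₀)
    (hb : Measurable b) (hC : ∀ᵐ ω ∂μ, |b (X ω)| ≤ C) :
    Integrable (fun ω => b (X ω) * (D (X ω) + η ω) ^ 2) μ := by
  have hL : MemLp (fun ω => D (X ω) + η ω) 2 μ :=
    (MemLp.of_bound (hD.comp hX).aestronglyMeasurable R₀ hDR).add h.memLp
  exact hL.integrable_sq.bdd_mul (hb.comp hX).aestronglyMeasurable hC

/-- Second moments of the residual `D(X) + η` weighted by a function of the covariate. -/
theorem IsNoise.second_moment_le (h : IsNoise μ σ X η) (hX : Measurable X) {D : E → ℝ} {R₀ : ℝ}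
    (hD : Measurable D) (hDR : ∀ᵐ ω ∂μ, |D (X ω)| ≤ R₀)
    (hb : Measurable b) (hC : ∀ᵐ ω ∂μ, |b (X ω)| ≤ C) (hb0 : ∀ x, 0 ≤ b x) :
    ∫ ω, b (X ω) * (D (X ω) + η ω) ^ 2 ∂μ ≤ (σ ^ 2 + R₀ ^ 2) * ∫ ω, b (X ω) ∂μ := by
  have ib : Integrable (fun ω => b (X ω)) μ :=
    Integrable.of_bound (hb.comp hX).aestronglyMeasurable C hC
  have hbD : ∀ᵐ ω ∂μ, |b (X ω) * D (X ω)| ≤ C * R₀ := by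
    filter_upwards [hC, hDR] with ω h1 h2
    rw [abs_mul]
    exact mul_le_mul h1 h2 (abs_nonneg _) ((abs_nonneg _).trans h1)
  have hD2 : ∀ᵐ ω ∂μ, |D (X ω) ^ 2| ≤ R₀ ^ 2 := by
    filter_upwards [hDR] with ω h2
    rw [abs_pow]
    exact pow_le_pow_left₀ (abs_nonneg _) h2 2
  have i1 : Integrable (fun ω => b (X ω) * D (X ω) ^ 2) μ :=
    ib.mul_bdd (((hD.pow_const 2).comp hX).aestronglyMeasurable) hD2
  have i2 : Integrable (fun ω => 2 * ((b (X ω) * D (X ω)) * η ω)) μ :=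
    ((h.memLp.integrable one_le_two).bdd_mul ((hb.mul hD).comp hX).aestronglyMeasurable
      hbD).const_mul 2
  have i3 : Integrable (fun ω => b (X ω) * η ω ^ 2) μ :=
    h.memLp.integrable_sq.bdd_mul (hb.comp hX).aestronglyMeasurable hC
  have e : (fun ω => b (X ω) * (D (X ω) + η ω) ^ 2) = fun ω =>
      b (X ω) * D (X ω) ^ 2 + 2 * ((b (X ω) * D (X ω)) * η ω) + b (X ω) * η ω ^ 2 := by
    ext ω; ring
  rw [e]
  -- The cross term vanishes by conditional centring, so bias and noise contribute `R₀²` and `σ²`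
  -- separately.
  have h0 : ∫ ω, (b (X ω) * D (X ω)) * η ω ∂μ = 0 :=
    h.integral_mul_eq_zero (b := fun x => b x * D x) hX (hb.mul hD) hbD
  rw [integral_add (f := fun ω => _ + _) (i1.add i2) i3, integral_add i1 i2, integral_const_mul, h0]
  have h1 : ∫ ω, b (X ω) * D (X ω) ^ 2 ∂μ ≤ R₀ ^ 2 * ∫ ω, b (X ω) ∂μ := by
    rw [mul_comm, ← integral_mul_const]
    refine integral_mono_ae i1 (ib.mul_const _) ?_
    filter_upwards [hD2] with ω hω
    exact mul_le_mul_of_nonneg_left ((le_abs_self _).trans hω) (hb0 _)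
  have h2 := h.integral_sq_mul_le hX hb hC hb0
  linarith

/-- First moment of the residual `D(X) + η` weighted by a function of the covariate. -/
theorem IsNoise.first_moment (h : IsNoise μ σ X η) (hX : Measurable X) {D : E → ℝ} {R₀ : ℝ}
    (hD : Measurable D) (hDR : ∀ᵐ ω ∂μ, |D (X ω)| ≤ R₀)
    (hb : Measurable b) (hC : ∀ᵐ ω ∂μ, |b (X ω)| ≤ C) :
    Integrable (fun ω => b (X ω) * (D (X ω) + η ω)) μ ∧
    ∫ ω, b (X ω) * (D (X ω) + η ω) ∂μ = ∫ ω, b (X ω) * D (X ω) ∂μ := by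
  have i1 : Integrable (fun ω => b (X ω) * D (X ω)) μ :=
    (Integrable.of_bound (hb.comp hX).aestronglyMeasurable C hC).mul_bdd
      (hD.comp hX).aestronglyMeasurable hDR
  have i2 : Integrable (fun ω => b (X ω) * η ω) μ :=
    (h.memLp.integrable one_le_two).bdd_mul (hb.comp hX).aestronglyMeasurable hC
  simp only [mul_add]
  refine ⟨i1.add i2, ?_⟩
  rw [integral_add i1 i2, h.integral_mul_eq_zero hX hb hC, add_zero]

end Noise

end LowPopArt

namespace LowPopArt

/-! ### The exponential moment of one truncated matrix. -/

section Moments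

variable {Ω E : Type*} [mΩ : MeasurableSpace Ω] [mE : MeasurableSpace E] {μ : Measure Ω}
  [IsProbabilityMeasure μ] {m : Type*} [Fintype m] [DecidableEq m]

theorem dotProduct_mulVec_mul_self {G : Matrix m m ℝ} (hG : G.IsHermitian) (z : m → ℝ) :
    z ⬝ᵥ ((G * G) *ᵥ z) = ∑ k, (G *ᵥ z) k ^ 2 := by
  rw [IsHermitian, conjTranspose_eq_transpose_of_trivial] at hG
  rw [← mulVec_mulVec, dotProduct_mulVec, ← mulVec_transpose, hG, dotProduct]
  exact Finset.sum_congr rfl fun k _ => (sq _).symm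

/-- Trace-exponential moment bound for an influence function applied to a residual times a bounded
random symmetric matrix. -/
theorem lintegral_trExp_influence_le {σ R₀ C B : ℝ} {X : Ω → E} {η : Ω → ℝ}
    (h : IsNoise μ σ X η) (hX : Measurable X) {D : E → ℝ}
    (hD : Measurable D) (hDR : ∀ᵐ ω ∂μ, |D (X ω)| ≤ R₀)
    {G : E → Matrix m m ℝ} (hG : Measurable G) (hGs : ∀ x, (G x).IsHermitian)
    (hGC : ∀ k l, ∀ᵐ ω ∂μ, |G (X ω) k l| ≤ C)
    (hB : ∀ z : m → ℝ, ∫ ω, ∑ k, (G (X ω) *ᵥ z) k ^ 2 ∂μ ≤ B * (z ⬝ᵥ z))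
    {φ : ℝ → ℝ} (hφ : IsInfluence φ) (ν : ℝ) {S : Matrix m m ℝ} (hS : S.IsHermitian) :
    ∫⁻ ω, ENNReal.ofReal (trExp (S + cfc φ (ν • (D (X ω) + η ω) • G (X ω)))) ∂μ
      ≤ ENNReal.ofReal (trExp (S + (ν • (Matrix.of fun k l => ∫ ω, G (X ω) k l * D (X ω) ∂μ)
        + (ν ^ 2 * ((σ ^ 2 + R₀ ^ 2) * B) / 2) • 1))) := by
  have hGm : ∀ k l, Measurable fun x => G x k l := fun k l =>
    (measurable_pi_apply l).comp ((measurable_pi_apply k).comp hG)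
  have hGGm : ∀ k l, Measurable fun x => (G x * G x) k l := fun k l => by
    simp only [mul_apply]
    exact Finset.measurable_sum _ fun j _ => (hGm k j).mul (hGm j l)
  have hall : ∀ᵐ ω ∂μ, ∀ k l, |G (X ω) k l| ≤ C := by
    rw [ae_all_iff]; intro k; rw [ae_all_iff]; exact hGC k
  have hGGC : ∀ k l, ∀ᵐ ω ∂μ, |(G (X ω) * G (X ω)) k l| ≤ ∑ _j : m, C * C := fun k l => by
    filter_upwards [hall] with ω hω
    rw [mul_apply]
    refine (Finset.abs_sum_le_sum_abs _ _).trans (Finset.sum_le_sum fun j _ => ?_)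
    rw [abs_mul]
    exact mul_le_mul (hω _ _) (hω _ _) (abs_nonneg _) ((abs_nonneg _).trans (hω k j))
  set H : Ω → Matrix m m ℝ := fun ω => ν • (D (X ω) + η ω) • G (X ω) with hH
  have hHs : ∀ ω, (H ω).IsHermitian := fun ω => by
    simp only [hH, IsHermitian, conjTranspose_smul, star_trivial, (hGs _).eq]
  have e1 : ∀ k l, (fun ω => H ω k l) = fun ω => ν * (G (X ω) k l * (D (X ω) + η ω)) := fun k l => by
    ext ω
    simp only [hH, Matrix.smul_apply, smul_eq_mul]
    ring
  have e2 : ∀ k l, (fun ω => (H ω * H ω) k l)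
      = fun ω => ν ^ 2 * ((G (X ω) * G (X ω)) k l * (D (X ω) + η ω) ^ 2) := fun k l => by
    ext ω
    simp only [hH, Matrix.smul_mul, Matrix.mul_smul, Matrix.smul_apply, smul_eq_mul]
    ring
  have m1 := fun k l => h.first_moment hX hD hDR (hGm k l) (hGC k l)
  have m2 := fun k l => h.integrable_mul_residual_sq hX hD hDR (hGGm k l) (hGGC k l)
  have iH : ∀ k l, Integrable (fun ω => H ω k l) μ := fun k l => by
    rw [e1]; exact (m1 k l).1.const_mul _
  have iHH : ∀ k l, Integrable (fun ω => (H ω * H ω) k l) μ := fun k l => by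
    rw [e2]; exact (m2 k l).const_mul _
  set A : Ω → Matrix m m ℝ := fun ω => 1 + H ω + (1 / 2 : ℝ) • (H ω * H ω) with hA
  have iA : ∀ k l, Integrable (fun ω => A ω k l) μ := fun k l => by
    simp only [hA, Matrix.add_apply, Matrix.smul_apply, smul_eq_mul]
    exact ((integrable_const _).add (iH k l)).add ((iHH k l).const_mul _)
  have hmean : (Matrix.of fun k l => ∫ ω, A ω k l ∂μ) - 1
      = ν • (Matrix.of fun k l => ∫ ω, G (X ω) k l * D (X ω) ∂μ)
        + (1 / 2 : ℝ) • Matrix.of fun k l => ∫ ω, (H ω * H ω) k l ∂μ := by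
    ext k l
    simp only [hA, Matrix.add_apply, Matrix.smul_apply, smul_eq_mul, Matrix.sub_apply, of_apply]
    rw [integral_add (f := fun ω => _ + _) ((integrable_const _).add (iH k l))
      ((iHH k l).const_mul _), integral_add (integrable_const _) (iH k l), integral_const_mul, e1,
      integral_const_mul, (m1 k l).2]
    simp
    ring
  -- Only the entrywise means of `H` and `H²` survive this step, which is why two moments of the
  -- noise suffice.
  refine (lintegral_trExp_add_le hS (Y := fun ω => cfc φ (H ω)) (A := A)
    (fun ω => isHermitian_cfc _ _) iA (fun ω => posSemidef_quadratic_sub_half (hHs ω))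
    (fun ω => hφ.posSemidef_log_sub (hHs ω))).trans (ENNReal.ofReal_le_ofReal ?_)
  rw [hmean]
  set EG : Matrix m m ℝ := Matrix.of fun k l => ∫ ω, G (X ω) k l * D (X ω) ∂μ with hEG
  set EH : Matrix m m ℝ := Matrix.of fun k l => ∫ ω, (H ω * H ω) k l ∂μ with hEH
  have hEGs : EG.IsHermitian := by
    ext k l
    rw [conjTranspose_apply, star_trivial, hEG, of_apply, of_apply]
    refine integral_congr_ae (ae_of_all _ fun ω => ?_)
    have := (hGs (X ω)).apply k l
    rw [star_trivial] at this
    dsimp only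
    rw [this]
  have hEHs : EH.IsHermitian := by
    ext k l
    rw [conjTranspose_apply, star_trivial, hEH, of_apply, of_apply]
    refine integral_congr_ae (ae_of_all _ fun ω => ?_)
    have h1 : (H ω * H ω).IsHermitian := by
      rw [IsHermitian, conjTranspose_mul, (hHs ω).eq]
    have := h1.apply k l
    rwa [star_trivial] at this
  have hsm : ∀ (c : ℝ) {M : Matrix m m ℝ}, M.IsHermitian → (c • M).IsHermitian := fun c M hM => by
    rw [IsHermitian, conjTranspose_smul, star_trivial, hM.eq]
  -- For fixed `z` the quadratic form of `H²` is the squared residual times the nonnegative weight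
  -- `ν²‖G(X)z‖²`, a function of the covariate alone.
  have hquad : ∀ z : m → ℝ, z ⬝ᵥ (EH *ᵥ z) ≤ ν ^ 2 * ((σ ^ 2 + R₀ ^ 2) * B) * (z ⬝ᵥ z) := by
    intro z
    have hb : ∀ x, (∑ k, (G x *ᵥ z) k ^ 2) = ∑ k, ∑ l, z k * z l * (G x * G x) k l := fun x => by
      rw [← dotProduct_mulVec_mul_self (hGs x)]
      simp only [dotProduct, mulVec, Finset.mul_sum]
      exact Finset.sum_congr rfl fun k _ => Finset.sum_congr rfl fun l _ => by ring
    have hbm : Measurable fun x => ∑ k, (G x *ᵥ z) k ^ 2 := by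
      simp only [hb]
      exact Finset.measurable_sum _ fun k _ => Finset.measurable_sum _ fun l _ =>
        (hGGm k l).const_mul _
    have hbC : ∀ᵐ ω ∂μ, |∑ k, (G (X ω) *ᵥ z) k ^ 2|
        ≤ ∑ k, ∑ l, |z k * z l| * ∑ _j : m, C * C := by
      have : ∀ᵐ ω ∂μ, ∀ k l, |(G (X ω) * G (X ω)) k l| ≤ ∑ _j : m, C * C := by
        rw [ae_all_iff]; intro k; rw [ae_all_iff]; exact hGGC k
      filter_upwards [this] with ω hω
      rw [hb]
      refine (Finset.abs_sum_le_sum_abs _ _).trans (Finset.sum_le_sum fun k _ => ?_)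
      refine (Finset.abs_sum_le_sum_abs _ _).trans (Finset.sum_le_sum fun l _ => ?_)
      rw [abs_mul]
      exact mul_le_mul_of_nonneg_left (hω k l) (abs_nonneg _)
    have h2 := h.second_moment_le hX hD hDR hbm hbC fun x => Finset.sum_nonneg fun k _ => sq_nonneg _
    have h3 : z ⬝ᵥ (EH *ᵥ z)
        = ν ^ 2 * ∫ ω, (∑ k, (G (X ω) *ᵥ z) k ^ 2) * (D (X ω) + η ω) ^ 2 ∂μ := by
      simp only [hb, Finset.sum_mul]
      rw [integral_finsetSum]
      · simp_rw [dotProduct, mulVec, dotProduct, hEH, of_apply, e2, integral_const_mul,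
          Finset.mul_sum]
        refine Finset.sum_congr rfl fun k _ => ?_
        rw [integral_finsetSum]
        · rw [Finset.mul_sum]
          refine Finset.sum_congr rfl fun l _ => ?_
          simp_rw [mul_assoc (z k * z l), integral_const_mul]
          ring
        · intro l _
          simp_rw [mul_assoc (z k * z l)]
          exact (m2 k l).const_mul _
      · intro k _
        refine integrable_finsetSum _ fun l _ => ?_
        simp_rw [mul_assoc (z k * z l)]
        exact (m2 k l).const_mul _
    rw [h3, mul_assoc]
    refine mul_le_mul_of_nonneg_left (h2.trans ?_) (sq_nonneg _)
    rw [mul_assoc]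
    exact mul_le_mul_of_nonneg_left (hB z) (by positivity)
  refine trExp_mono (hS.add ((hsm _ hEGs).add (hsm _ hEHs)))
    (hS.add ((hsm _ hEGs).add (isHermitian_smul_one _))) ?_
  rw [add_sub_add_left_eq_sub, add_sub_add_left_eq_sub]
  refine PosSemidef.of_dotProduct_mulVec_nonneg ((isHermitian_smul_one _).sub (hsm _ hEHs))
    fun z => ?_
  rw [star_trivial, sub_mulVec, dotProduct_sub, smul_mulVec, one_mulVec, dotProduct_smul,
    smul_mulVec, dotProduct_smul, smul_eq_mul, smul_eq_mul]
  linarith [hquad z]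

end Moments

end LowPopArt

namespace LowPopArt

/-! ### Moments of the whitened covariate and the constant `B(Q)`. -/

section Covariance

variable {d₁ d₂ : ℕ} {Ω : Type*} [MeasurableSpace Ω] {μ : Measure Ω} [IsProbabilityMeasure μ]
  {X : Ω → Matrix (Fin d₁) (Fin d₂) ℝ} {π : Measure (Matrix (Fin d₁) (Fin d₂) ℝ)}

theorem measurable_entry (i : Fin d₁) (j : Fin d₂) :
    Measurable fun A : Matrix (Fin d₁) (Fin d₂) ℝ => A i j :=
  (measurable_pi_apply j).comp (measurable_pi_apply i)

theorem abs_entry_le_frobNorm (A : Matrix (Fin d₁) (Fin d₂) ℝ) (i : Fin d₁) (j : Fin d₂) :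
    |A i j| ≤ frobNorm A := by
  refine Real.abs_le_sqrt ?_
  exact (Finset.single_le_sum (f := fun j => A i j ^ 2) (fun j _ => sq_nonneg _)
    (Finset.mem_univ j)).trans (Finset.single_le_sum (f := fun i => ∑ j, A i j ^ 2)
      (fun i _ => Finset.sum_nonneg fun j _ => sq_nonneg _) (Finset.mem_univ i))

theorem popCov_apply (hX : Measurable X) (hXπ : μ.map X = π) (p q : Fin d₂ × Fin d₁) :
    popCov π p q = ∫ ω, X ω p.2 p.1 * X ω q.2 q.1 ∂μ := by
  rw [popCov, of_apply, ← hXπ, integral_map hX.aemeasurable]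
  · rfl
  · exact ((measurable_entry p.2 p.1).mul (measurable_entry q.2 q.1)).aestronglyMeasurable

theorem popCov_isHermitian : (popCov π).IsHermitian := by
  ext p q
  rw [conjTranspose_apply, star_trivial, popCov, of_apply, of_apply]
  simp only [mul_comm]

theorem transpose_popCov : (popCov π)ᵀ = popCov π := by
  have := popCov_isHermitian (π := π)
  rwa [IsHermitian, conjTranspose_eq_transpose_of_trivial] at this

theorem integrable_entry_mul (hX : Measurable X) {C : ℝ}
    (hC : ∀ᵐ ω ∂μ, ∀ i j, |X ω i j| ≤ C) (i k : Fin d₁) (j l : Fin d₂) :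
    Integrable (fun ω => X ω i j * X ω k l) μ := by
  refine Integrable.of_bound (((measurable_entry i j).comp hX).mul
    ((measurable_entry k l).comp hX)).aestronglyMeasurable (C * C) ?_
  filter_upwards [hC] with ω hω
  rw [Real.norm_eq_abs, abs_mul]
  exact mul_le_mul (hω _ _) (hω _ _) (abs_nonneg _) ((abs_nonneg _).trans (hω i j))

/-- Covariance of linear functionals of the covariate. -/
theorem integral_linear_mul_linear (hX : Measurable X) (hXπ : μ.map X = π) {C : ℝ}
    (hC : ∀ᵐ ω ∂μ, ∀ i j, |X ω i j| ≤ C) (u v : Fin d₂ × Fin d₁ → ℝ) :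
    ∫ ω, (u ⬝ᵥ vec (X ω)) * (v ⬝ᵥ vec (X ω)) ∂μ = u ⬝ᵥ (popCov π *ᵥ v) := by
  have e : ∀ ω, (u ⬝ᵥ vec (X ω)) * (v ⬝ᵥ vec (X ω))
      = ∑ p, ∑ q, u p * v q * (X ω p.2 p.1 * X ω q.2 q.1) := fun ω => by
    simp only [dotProduct, Finset.sum_mul_sum, vec]
    exact Finset.sum_congr rfl fun p _ => Finset.sum_congr rfl fun q _ => by ring
  have hi := fun p q : Fin d₂ × Fin d₁ =>
    (integrable_entry_mul hX hC p.2 q.2 p.1 q.1).const_mul (u p * v q)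
  simp only [e]
  rw [integral_finsetSum _ fun p _ => integrable_finsetSum _ fun q _ => hi p q]
  simp only [dotProduct, mulVec, Finset.mul_sum]
  refine Finset.sum_congr rfl fun p _ => ?_
  rw [integral_finsetSum _ fun q _ => hi p q]
  refine Finset.sum_congr rfl fun q _ => ?_
  rw [integral_const_mul, popCov_apply hX hXπ]
  ring

theorem popCov_posDef (hX : Measurable X) (hXπ : μ.map X = π) {C : ℝ}
    (hC : ∀ᵐ ω ∂μ, ∀ i j, |X ω i j| ≤ C) (hQ : IsUnit (popCov π)) : (popCov π).PosDef := by
  have h : (popCov π).PosSemidef := by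
    refine PosSemidef.of_dotProduct_mulVec_nonneg popCov_isHermitian fun u => ?_
    rw [star_trivial, ← integral_linear_mul_linear hX hXπ hC]
    exact integral_nonneg fun ω => mul_self_nonneg _
  exact h.posDef_iff_isUnit.2 hQ

theorem sum_blockCol_posDef [NeZero d₂] {Q : Matrix (Fin d₂ × Fin d₁) (Fin d₂ × Fin d₁) ℝ}
    (hQ : Q.PosDef) : (∑ c, blockCol Q c).PosDef :=
  posDef_sum Finset.univ_nonempty fun c _ => hQ.inv.submatrix (e := fun i => (c, i))
    fun _ _ h => (Prod.ext_iff.1 h).2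

theorem sum_blockRow_posDef [NeZero d₁] {Q : Matrix (Fin d₂ × Fin d₁) (Fin d₂ × Fin d₁) ℝ}
    (hQ : Q.PosDef) : (∑ a, blockRow Q a).PosDef :=
  posDef_sum Finset.univ_nonempty fun a _ => hQ.inv.submatrix (e := fun j => (j, a))
    fun _ _ h => (Prod.ext_iff.1 h).1

theorem BQ_pos [NeZero d₁] [NeZero d₂] {Q : Matrix (Fin d₂ × Fin d₁) (Fin d₂ × Fin d₁) ℝ}
    (hQ : Q.PosDef) : 0 < BQ Q :=
  (lambdaMax_pos (sum_blockCol_posDef hQ)).trans_le (le_max_left _ _)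

/-- The whitened covariate `reshape(Q⁻¹ vec(A))`. -/
noncomputable def whiten (Q : Matrix (Fin d₂ × Fin d₁) (Fin d₂ × Fin d₁) ℝ)
    (A : Matrix (Fin d₁) (Fin d₂) ℝ) : Matrix (Fin d₁) (Fin d₂) ℝ :=
  reshape (Q⁻¹ *ᵥ vec A)

theorem whiten_apply (Q : Matrix (Fin d₂ × Fin d₁) (Fin d₂ × Fin d₁) ℝ)
    (A : Matrix (Fin d₁) (Fin d₂) ℝ) (i : Fin d₁) (j : Fin d₂) :
    whiten Q A i j = Q⁻¹ (j, i) ⬝ᵥ vec A := rfl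

theorem oneSample_eq (Q : Matrix (Fin d₂ × Fin d₁) (Fin d₂ × Fin d₁) ℝ)
    (Θ₀ A : Matrix (Fin d₁) (Fin d₂) ℝ) (y : ℝ) :
    oneSample Q Θ₀ A y = (y - traceInner Θ₀ A) • whiten Q A := by
  rw [oneSample, whiten, mulVec_smul]
  rfl

theorem dilation_smul (c : ℝ) (M : Matrix (Fin d₁) (Fin d₂) ℝ) :
    dilation (c • M) = c • dilation M := by
  simp [dilation, fromBlocks_smul]

theorem traceInner_eq (A B : Matrix (Fin d₁) (Fin d₂) ℝ) : traceInner A B = vec A ⬝ᵥ vec B := by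
  simp only [traceInner, trace, diag_apply, mul_apply, transpose_apply, dotProduct, vec,
    Fintype.sum_prod_type]

theorem measurable_traceInner (Θ : Matrix (Fin d₁) (Fin d₂) ℝ) :
    Measurable fun A => traceInner Θ A := by
  simp only [traceInner_eq, dotProduct]
  exact Finset.measurable_sum _ fun p _ => (measurable_entry p.2 p.1).const_mul _

theorem measurable_whiten (Q : Matrix (Fin d₂ × Fin d₁) (Fin d₂ × Fin d₁) ℝ) :
    Measurable (whiten Q) := by
  refine measurable_pi_iff.2 fun i => measurable_pi_iff.2 fun j => ?_
  simp only [whiten_apply, dotProduct]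
  exact Finset.measurable_sum _ fun p _ => (measurable_entry p.2 p.1).const_mul _

theorem abs_whiten_le (Q : Matrix (Fin d₂ × Fin d₁) (Fin d₂ × Fin d₁) ℝ) {C : ℝ}
    {A : Matrix (Fin d₁) (Fin d₂) ℝ} (hA : ∀ i j, |A i j| ≤ C) (i : Fin d₁) (j : Fin d₂) :
    |whiten Q A i j| ≤ ∑ p, ∑ q, |Q⁻¹ p q| * C := by
  have h0 : 0 ≤ C := (abs_nonneg _).trans (hA i j)
  rw [whiten_apply, dotProduct]
  refine (Finset.abs_sum_le_sum_abs _ _).trans (le_trans (Finset.sum_le_sum fun q _ => ?_)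
    (Finset.single_le_sum (f := fun p => ∑ q, |Q⁻¹ p q| * C)
      (fun p _ => Finset.sum_nonneg fun q _ => by positivity) (Finset.mem_univ (j, i))))
  rw [abs_mul]
  exact mul_le_mul_of_nonneg_left (hA q.2 q.1) (abs_nonneg _)

theorem measurable_dilation :
    Measurable (dilation : Matrix (Fin d₁) (Fin d₂) ℝ → _) := by
  have : Continuous (dilation : Matrix (Fin d₁) (Fin d₂) ℝ → _) := by
    unfold dilation
    fun_prop
  exact this.measurable

/-- Unbiasedness of the one-sample estimator: averaging `vec X (vec X)ᵀ` gives `Q`, which cancels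
`Q⁻¹`. -/
theorem integral_dilation_whiten_mul (hX : Measurable X) (hXπ : μ.map X = π) {C : ℝ}
    (hC : ∀ᵐ ω ∂μ, ∀ i j, |X ω i j| ≤ C) (hQ : IsUnit (popCov π))
    (Δ : Matrix (Fin d₁) (Fin d₂) ℝ) :
    (Matrix.of fun k l => ∫ ω, dilation (whiten (popCov π) (X ω)) k l * traceInner Δ (X ω) ∂μ)
      = dilation Δ := by
  have h : ∀ i j, ∫ ω, whiten (popCov π) (X ω) i j * traceInner Δ (X ω) ∂μ = Δ i j := by
    intro i j
    simp only [whiten_apply, traceInner_eq]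
    rw [integral_linear_mul_linear hX hXπ hC]
    change ((popCov π)⁻¹ *ᵥ (popCov π *ᵥ vec Δ)) (j, i) = _
    rw [mulVec_mulVec, nonsing_inv_mul _ ((isUnit_iff_isUnit_det _).1 hQ), one_mulVec]
    rfl
  ext (k | k) (l | l) <;> simp [dilation, h]

theorem integral_whiten_mul_whiten (hX : Measurable X) (hXπ : μ.map X = π) {C : ℝ}
    (hC : ∀ᵐ ω ∂μ, ∀ i j, |X ω i j| ≤ C) (hQ : IsUnit (popCov π)) (i k : Fin d₁) (j l : Fin d₂) :
    Integrable (fun ω => whiten (popCov π) (X ω) i j * whiten (popCov π) (X ω) k l) μ ∧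
    ∫ ω, whiten (popCov π) (X ω) i j * whiten (popCov π) (X ω) k l ∂μ
      = (popCov π)⁻¹ (j, i) (l, k) := by
  have hdet := (isUnit_iff_isUnit_det _).1 hQ
  constructor
  · set K := ∑ p, ∑ q, |(popCov π)⁻¹ p q| * C
    refine Integrable.of_bound (((measurable_entry i j).comp ((measurable_whiten _).comp hX)).mul
      ((measurable_entry k l).comp ((measurable_whiten _).comp hX))).aestronglyMeasurable (K * K) ?_
    filter_upwards [hC] with ω hω
    rw [Real.norm_eq_abs, abs_mul]
    have h := abs_whiten_le (popCov π) hω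
    exact mul_le_mul (h i j) (h k l) (abs_nonneg _) ((abs_nonneg _).trans (h i j))
  · simp only [whiten_apply]
    rw [integral_linear_mul_linear hX hXπ hC]
    have h1 : (popCov π)⁻¹ (l, k) = (popCov π)⁻¹ *ᵥ Pi.single (l, k) 1 := by
      ext p
      rw [mulVec_single_one, col_apply]
      have := congrFun (congrFun (transpose_nonsing_inv (popCov π)) p) (l, k)
      rw [transpose_popCov] at this
      exact this
    rw [h1, mulVec_mulVec, mul_nonsing_inv _ hdet, one_mulVec]
    simp

/-- With `W` the whitened covariate, the square of its dilation is block diagonal with blocks `W Wᵀ`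
and `Wᵀ W`. Since `vec W` has second moment `Q⁻¹`, the expected blocks are the sums of the column
and of the row submatrices of `Q⁻¹`. -/
theorem integral_sq_dilation_whiten_le (hX : Measurable X) (hXπ : μ.map X = π) {C : ℝ}
    (hC : ∀ᵐ ω ∂μ, ∀ i j, |X ω i j| ≤ C) (hQ : IsUnit (popCov π)) [NeZero d₁] [NeZero d₂]
    (z : Fin d₁ ⊕ Fin d₂ → ℝ) :
    ∫ ω, ∑ k, (dilation (whiten (popCov π) (X ω)) *ᵥ z) k ^ 2 ∂μ ≤ BQ (popCov π) * (z ⬝ᵥ z) := by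
  have hpd := popCov_posDef hX hXπ hC hQ
  have hw := integral_whiten_mul_whiten hX hXπ hC hQ
  set Q := popCov π
  set x : Fin d₁ → ℝ := fun i => z (Sum.inl i)
  set y : Fin d₂ → ℝ := fun j => z (Sum.inr j)
  have e : ∀ ω, ∑ k, (dilation (whiten Q (X ω)) *ᵥ z) k ^ 2
      = ∑ i, ∑ j, ∑ l, y j * y l * (whiten Q (X ω) i j * whiten Q (X ω) i l)
        + ∑ j, ∑ i, ∑ k, x i * x k * (whiten Q (X ω) i j * whiten Q (X ω) k j) := fun ω => by
    simp only [Fintype.sum_sum_type, dilation, mulVec, dotProduct, fromBlocks_apply₁₁,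
      fromBlocks_apply₁₂, fromBlocks_apply₂₁, fromBlocks_apply₂₂, Matrix.zero_apply, zero_mul,
      Finset.sum_const_zero, zero_add, add_zero, transpose_apply, sq, Finset.sum_mul_sum]
    congr 1 <;>
    exact Finset.sum_congr rfl fun i _ => Finset.sum_congr rfl fun j _ =>
      Finset.sum_congr rfl fun l _ => by ring
  have i1 : ∀ i j l, Integrable (fun ω =>
      y j * y l * (whiten Q (X ω) i j * whiten Q (X ω) i l)) μ :=
    fun i j l => (hw i i j l).1.const_mul _
  have i2 : ∀ j i k, Integrable (fun ω =>
      x i * x k * (whiten Q (X ω) i j * whiten Q (X ω) k j)) μ :=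
    fun j i k => (hw i k j j).1.const_mul _
  have s1 := fun i j => integrable_finsetSum Finset.univ fun l _ => i1 i j l
  have s2 := fun j i => integrable_finsetSum Finset.univ fun k _ => i2 j i k
  have t1 := fun i => integrable_finsetSum Finset.univ fun j _ => s1 i j
  have t2 := fun j => integrable_finsetSum Finset.univ fun i _ => s2 j i
  have q1 : ∫ ω, ∑ i, ∑ j, ∑ l, y j * y l * (whiten Q (X ω) i j * whiten Q (X ω) i l) ∂μ
      = y ⬝ᵥ ((∑ a, blockRow Q a) *ᵥ y) := by
    rw [integral_finsetSum _ fun i _ => t1 i]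
    simp_rw [integral_finsetSum _ fun j _ => s1 _ j, integral_finsetSum _ fun l _ => i1 _ _ l,
      integral_const_mul, (hw _ _ _ _).2, dotProduct, mulVec, dotProduct, Matrix.sum_apply, Finset.mul_sum,
      Finset.sum_mul, Finset.mul_sum]
    rw [Finset.sum_comm]
    refine Finset.sum_congr rfl fun j _ => ?_
    rw [Finset.sum_comm]
    refine Finset.sum_congr rfl fun l _ => Finset.sum_congr rfl fun i _ => ?_
    rw [blockRow, of_apply]
    ring
  have q2 : ∫ ω, ∑ j, ∑ i, ∑ k, x i * x k * (whiten Q (X ω) i j * whiten Q (X ω) k j) ∂μ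
      = x ⬝ᵥ ((∑ c, blockCol Q c) *ᵥ x) := by
    rw [integral_finsetSum _ fun i _ => t2 i]
    simp_rw [integral_finsetSum _ fun j _ => s2 _ j, integral_finsetSum _ fun l _ => i2 _ _ l,
      integral_const_mul, (hw _ _ _ _).2, dotProduct, mulVec, dotProduct, Matrix.sum_apply, Finset.mul_sum,
      Finset.sum_mul, Finset.mul_sum]
    rw [Finset.sum_comm]
    refine Finset.sum_congr rfl fun j _ => ?_
    rw [Finset.sum_comm]
    refine Finset.sum_congr rfl fun l _ => Finset.sum_congr rfl fun i _ => ?_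
    rw [blockCol, of_apply]
    ring
  have hz : z ⬝ᵥ z = x ⬝ᵥ x + y ⬝ᵥ y := by
    simp [dotProduct, Fintype.sum_sum_type, x, y]
  simp only [e]
  rw [integral_add (integrable_finsetSum _ fun i _ => t1 i)
    (integrable_finsetSum _ fun i _ => t2 i), q1, q2, hz, mul_add, add_comm]
  have hx : 0 ≤ x ⬝ᵥ x := Finset.sum_nonneg fun i _ => mul_self_nonneg _
  have hy : 0 ≤ y ⬝ᵥ y := Finset.sum_nonneg fun i _ => mul_self_nonneg _
  exact add_le_add
    ((dotProduct_mulVec_le_lambdaMax (sum_blockCol_posDef hpd).1 x).trans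
      (mul_le_mul_of_nonneg_right (le_max_left _ _) hx))
    ((dotProduct_mulVec_le_lambdaMax (sum_blockRow_posDef hpd).1 y).trans
      (mul_le_mul_of_nonneg_right (le_max_right _ _) hy))

end Covariance

/-! ### From a one-sided bound to the operator norm. -/

section Block

variable {d₁ d₂ : ℕ}

/-- A one-sided bound on a symmetric matrix with vanishing diagonal blocks bounds the operator norm
of its off-diagonal block. -/
theorem norm_toBlocks₁₂_le {P : Matrix (Fin d₁ ⊕ Fin d₂) (Fin d₁ ⊕ Fin d₂) ℝ} (hP : P.IsHermitian)
    (h₁ : P.toBlocks₁₁ = 0) (h₂ : P.toBlocks₂₂ = 0) {c : ℝ} (hc : 0 < c)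
    (h : (c • (1 : Matrix (Fin d₁ ⊕ Fin d₂) (Fin d₁ ⊕ Fin d₂) ℝ) - P).PosSemidef)
    (y : EuclideanSpace ℝ (Fin d₂)) :
    ‖toEuclideanLin P.toBlocks₁₂ y‖ ≤ c * ‖y‖ := by
  set B := P.toBlocks₁₂ with hB
  have hB' : P.toBlocks₂₁ = Bᵀ := by
    rw [IsHermitian, conjTranspose_eq_transpose_of_trivial] at hP
    ext i j
    exact congrFun (congrFun hP.symm (Sum.inr i)) (Sum.inl j)
  set w : Fin d₁ → ℝ := B *ᵥ y.ofLp with hw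
  -- Testing on `(c⁻¹ B y, y)` gives `c‖y‖² + c⁻¹‖By‖² - 2c⁻¹‖By‖² ≥ 0`, which is the claim squared.
  have h1 := h.dotProduct_mulVec_nonneg (Sum.elim (c⁻¹ • w) y.ofLp)
  have h2 : P *ᵥ Sum.elim (c⁻¹ • w) y.ofLp = Sum.elim w (c⁻¹ • (Bᵀ *ᵥ w)) := by
    conv_lhs => rw [← fromBlocks_toBlocks P, h₁, h₂, hB', ← hB, fromBlocks_mulVec]
    simp [← hw, mulVec_smul]
  have h3 : y.ofLp ⬝ᵥ (Bᵀ *ᵥ w) = w ⬝ᵥ w := by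
    rw [mulVec_transpose, dotProduct_comm, ← dotProduct_mulVec, hw]
  rw [star_trivial, sub_mulVec, dotProduct_sub, smul_mulVec, one_mulVec, dotProduct_smul, h2,
    sumElim_dotProduct_sumElim, sumElim_dotProduct_sumElim, smul_dotProduct, dotProduct_smul,
    smul_dotProduct, dotProduct_smul, h3] at h1
  simp only [smul_eq_mul] at h1
  have n1 : ‖toEuclideanLin B y‖ ^ 2 = w ⬝ᵥ w := by
    rw [EuclideanSpace.real_norm_sq_eq, dotProduct]
    exact Finset.sum_congr rfl fun i _ => by rw [toLpLin_apply, sq]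
  have n2 : ‖y‖ ^ 2 = y.ofLp ⬝ᵥ y.ofLp := by
    rw [EuclideanSpace.real_norm_sq_eq, dotProduct]
    exact Finset.sum_congr rfl fun i _ => by rw [sq]
  refine le_of_sq_le_sq ?_ (by positivity)
  rw [mul_pow, n1, n2]
  have h4 : c * (c⁻¹ * (c⁻¹ * (w ⬝ᵥ w))) = c⁻¹ * (w ⬝ᵥ w) := by field_simp
  have h5 : c⁻¹ * (w ⬝ᵥ w) ≤ c * (y.ofLp ⬝ᵥ y.ofLp) := by linarith
  rw [inv_mul_le_iff₀ hc] at h5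
  linarith

end Block

end LowPopArt

namespace LowPopArt

/-! ### Concentration of the robust mean estimator. -/

section Estimator

variable {d₁ d₂ : ℕ} {Ω : Type*} [MeasurableSpace Ω] {μ : Measure Ω} [IsProbabilityMeasure μ]

theorem truncParam_mul_threshold {V L : ℝ} (hV : 0 < V) (hL : 0 < L) {n : ℕ} (hn : 0 < n) :
    n * √(L / (V * n)) * (2 * √(V * L / n)) = 2 * L := by
  have hn' : (0 : ℝ) < n := by exact_mod_cast hn
  have h : √(L / (V * n)) * √(V * L / n) = L / n := by
    rw [← Real.sqrt_mul (by positivity), show L / (V * n) * (V * L / n) = (L / n) ^ 2 by field_simp]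
    exact Real.sqrt_sq (by positivity)
  calc n * √(L / (V * n)) * (2 * √(V * L / n)) = 2 * n * (√(L / (V * n)) * √(V * L / n)) := by ring
    _ = 2 * L := by rw [h]; field_simp

/-- Trace-exponential bound for a single sample. -/
theorem lintegral_trExp_oneSample_le [NeZero d₁] [NeZero d₂]
    {π : Measure (Matrix (Fin d₁) (Fin d₂) ℝ)} (hQ : IsUnit (popCov π))
    {X : Ω → Matrix (Fin d₁) (Fin d₂) ℝ} (hX : Measurable X) (hXπ : μ.map X = π) {C : ℝ}
    (hC : ∀ᵐ ω ∂μ, ∀ i j, |X ω i j| ≤ C) {σ R₀ : ℝ} {η : Ω → ℝ} (hη : IsNoise μ σ X η)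
    {Θs Θ₀ : Matrix (Fin d₁) (Fin d₂) ℝ} (hR : ∀ᵐ ω ∂μ, |traceInner (Θs - Θ₀) (X ω)| ≤ R₀)
    {ψ : ℝ → ℝ} (hψ : IsInfluence ψ) (ν : ℝ)
    {S : Matrix (Fin d₁ ⊕ Fin d₂) (Fin d₁ ⊕ Fin d₂) ℝ} (hS : S.IsHermitian) :
    ∫⁻ ω, ENNReal.ofReal (trExp (S + cfc ψ (ν • dilation (oneSample (popCov π) Θ₀ (X ω)
        (traceInner Θs (X ω) + η ω))))) ∂μ
      ≤ ENNReal.ofReal (trExp (S + (ν • dilation (Θs - Θ₀)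
        + (ν ^ 2 * ((σ ^ 2 + R₀ ^ 2) * BQ (popCov π)) / 2) • 1))) := by
  have h := lintegral_trExp_influence_le (μ := μ) (C := ∑ p, ∑ q, |(popCov π)⁻¹ p q| * C) hη hX
    (measurable_traceInner (Θs - Θ₀)) hR
    (G := fun A => dilation (whiten (popCov π) A)) (measurable_dilation.comp (measurable_whiten _))
    (fun A => isHermitian_dilation _) ?_ (integral_sq_dilation_whiten_le hX hXπ hC hQ) hψ ν hS
  · rw [integral_dilation_whiten_mul hX hXπ hC hQ] at h
    refine le_trans (le_of_eq (lintegral_congr fun ω => ?_)) h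
    rw [oneSample_eq, dilation_smul]
    congr 7
    simp only [traceInner_eq, vec_sub, sub_dotProduct]
    ring
  · intro k l
    filter_upwards [hC] with ω hω
    have hw := abs_whiten_le (popCov π) hω
    have h0 : 0 ≤ ∑ p, ∑ q, |(popCov π)⁻¹ p q| * C :=
      (abs_nonneg _).trans (hw 0 0)
    rcases k with k | k <;> rcases l with l | l <;> simp [dilation, h0, hw]

theorem measurable_oneSample (Q : Matrix (Fin d₂ × Fin d₁) (Fin d₂ × Fin d₁) ℝ)
    (Θ₀ Θs : Matrix (Fin d₁) (Fin d₂) ℝ) :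
    Measurable fun p : Matrix (Fin d₁) (Fin d₂) ℝ × ℝ =>
      oneSample Q Θ₀ p.1 (traceInner Θs p.1 + p.2) := by
  simp only [oneSample_eq]
  exact ((((measurable_traceInner Θs).comp measurable_fst).add measurable_snd).sub
    ((measurable_traceInner Θ₀).comp measurable_fst)).smul
      ((measurable_whiten Q).comp measurable_fst)

/-- The centred sum of the truncated dilations. -/
noncomputable def centredSum {n : ℕ} (φ : ℝ → ℝ) (ν : ℝ)
    (Q : Matrix (Fin d₂ × Fin d₁) (Fin d₂ × Fin d₁) ℝ) (Θ₀ Θs : Matrix (Fin d₁) (Fin d₂) ℝ)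
    (X : Fin n → Matrix (Fin d₁) (Fin d₂) ℝ) (y : Fin n → ℝ) :
    Matrix (Fin d₁ ⊕ Fin d₂) (Fin d₁ ⊕ Fin d₂) ℝ :=
  -((n * ν) • dilation (Θs - Θ₀)) +
    ∑ i, cfc (oddPart φ) (ν • dilation (oneSample Q Θ₀ (X i) (y i)))

theorem isHermitian_centredSum {n : ℕ} (φ : ℝ → ℝ) (ν : ℝ)
    (Q : Matrix (Fin d₂ × Fin d₁) (Fin d₂ × Fin d₁) ℝ) (Θ₀ Θs : Matrix (Fin d₁) (Fin d₂) ℝ)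
    (X : Fin n → Matrix (Fin d₁) (Fin d₂) ℝ) (y : Fin n → ℝ) :
    (centredSum φ ν Q Θ₀ Θs X y).IsHermitian := by
  refine IsHermitian.add ?_ ?_
  · rw [← dilation_smul]
    exact (isHermitian_dilation _).neg
  · rw [IsHermitian, conjTranspose_sum]
    exact Finset.sum_congr rfl fun i _ => isHermitian_cfc _ _

theorem centredSum_eq_fromBlocks {n : ℕ} (φ : ℝ → ℝ) (ν : ℝ)
    (Q : Matrix (Fin d₂ × Fin d₁) (Fin d₂ × Fin d₁) ℝ) (Θ₀ Θs : Matrix (Fin d₁) (Fin d₂) ℝ)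
    (X : Fin n → Matrix (Fin d₁) (Fin d₂) ℝ) (y : Fin n → ℝ) :
    (centredSum φ ν Q Θ₀ Θs X y).toBlocks₁₁ = 0 ∧ (centredSum φ ν Q Θ₀ Θs X y).toBlocks₂₂ = 0 ∧
    (centredSum φ ν Q Θ₀ Θs X y).toBlocks₁₂ = -((n * ν) • (Θs - Θ₀)) +
      (∑ i, cfc φ (ν • dilation (oneSample Q Θ₀ (X i) (y i)))).toBlocks₁₂ := by
  have h : ∀ i k l, cfc (oddPart φ) (ν • dilation (oneSample Q Θ₀ (X i) (y i))) k l
      = fromBlocks 0 (cfc φ (ν • dilation (oneSample Q Θ₀ (X i) (y i)))).toBlocks₁₂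
        (cfc φ (ν • dilation (oneSample Q Θ₀ (X i) (y i)))).toBlocks₂₁ 0 k l := fun i k l => by
    rw [← dilation_smul, cfc_oddPart_dilation]
  have hd : ∀ k l, dilation (Θs - Θ₀) k l = fromBlocks 0 (Θs - Θ₀) (Θs - Θ₀)ᵀ 0 k l :=
    fun _ _ => rfl
  refine ⟨?_, ?_, ?_⟩ <;> ext k l <;>
    simp [toBlocks₁₁, toBlocks₂₂, toBlocks₁₂, centredSum, Matrix.sum_apply, h, hd]

/-- If the centred sum is bounded above by `c`, the robust mean is within `c / (n ν)` of the target
in operator norm. -/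
theorem norm_robustMean_sub_le {n : ℕ} (hn : 0 < n) {φ : ℝ → ℝ} {ν c τ : ℝ} (hν : 0 < ν)
    (hc : 0 < c) (hcτ : n * ν * τ = c) {Q : Matrix (Fin d₂ × Fin d₁) (Fin d₂ × Fin d₁) ℝ}
    {Θ₀ Θs : Matrix (Fin d₁) (Fin d₂) ℝ}
    {X : Fin n → Matrix (Fin d₁) (Fin d₂) ℝ} {y : Fin n → ℝ}
    (h : (c • (1 : Matrix (Fin d₁ ⊕ Fin d₂) (Fin d₁ ⊕ Fin d₂) ℝ)
      - centredSum φ ν Q Θ₀ Θs X y).PosSemidef) (x : EuclideanSpace ℝ (Fin d₂)) :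
    ‖toEuclideanLin (robustMean φ ν Q Θ₀ X y - Θs) x‖ ≤ τ * ‖x‖ := by
  obtain ⟨h1, h2, h3⟩ := centredSum_eq_fromBlocks φ ν Q Θ₀ Θs X y
  have h4 := norm_toBlocks₁₂_le (isHermitian_centredSum φ ν Q Θ₀ Θs X y) h1 h2 hc h x
  have hnν : 0 < n * ν := mul_pos (by exact_mod_cast hn) hν
  have h5 : (centredSum φ ν Q Θ₀ Θs X y).toBlocks₁₂
      = (n * ν) • (robustMean φ ν Q Θ₀ X y - Θs) := by
    have e : ((1 / (n * ν)) • ∑ i, cfc φ (ν • dilation (oneSample Q Θ₀ (X i) (y i)))).toBlocks₁₂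
        = (1 / (n * ν)) •
          (∑ i, cfc φ (ν • dilation (oneSample Q Θ₀ (X i) (y i)))).toBlocks₁₂ := rfl
    rw [h3, robustMean, e, add_sub_right_comm, smul_add, smul_smul, mul_one_div_cancel hnν.ne',
      one_smul, ← smul_neg, neg_sub]
  rw [h5, map_smul, LinearMap.smul_apply, norm_smul, Real.norm_of_nonneg hnν.le, ← hcτ,
    mul_assoc (n * ν) τ] at h4
  exact le_of_mul_le_mul_left h4 hnν

theorem measurable_centredSum {n : ℕ} {φ : ℝ → ℝ} (hφ : IsInfluence φ) (ν : ℝ)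
    (Q : Matrix (Fin d₂ × Fin d₁) (Fin d₂ × Fin d₁) ℝ) (Θ₀ Θs : Matrix (Fin d₁) (Fin d₂) ℝ)
    {X : Fin n → Ω → Matrix (Fin d₁) (Fin d₂) ℝ} {η : Fin n → Ω → ℝ}
    (hX : ∀ i, Measurable (X i)) (hη : ∀ i, Measurable (η i)) :
    Measurable fun ω => centredSum φ ν Q Θ₀ Θs (fun i => X i ω)
      fun i => traceInner Θs (X i ω) + η i ω := by
  refine measurable_const.add (Finset.measurable_sum _ fun i _ => ?_)
  refine measurable_cfc hφ.oddPart.continuous ?_ fun ω => by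
    rw [← dilation_smul]; exact isHermitian_dilation _
  exact (measurable_dilation.comp ((measurable_oneSample Q Θ₀ Θs).comp
    ((hX i).prodMk (hη i)))).const_smul ν

/-- Trace-exponential bound for the centred sum. -/
theorem lintegral_trExp_centredSum_le [NeZero d₁] [NeZero d₂] {n : ℕ}
    {π : Measure (Matrix (Fin d₁) (Fin d₂) ℝ)} (hQ : IsUnit (popCov π))
    {X : Fin n → Ω → Matrix (Fin d₁) (Fin d₂) ℝ} {η : Fin n → Ω → ℝ}
    (hX : ∀ i, Measurable (X i)) (hXπ : ∀ i, μ.map (X i) = π) {C : ℝ}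
    (hC : ∀ i, ∀ᵐ ω ∂μ, ∀ k l, |X i ω k l| ≤ C) {σ R₀ : ℝ} (hη : ∀ i, IsNoise μ σ (X i) (η i))
    (hind : iIndepFun (fun i ω => (X i ω, η i ω)) μ)
    {Θs Θ₀ : Matrix (Fin d₁) (Fin d₂) ℝ}
    (hR : ∀ i, ∀ᵐ ω ∂μ, |traceInner (Θs - Θ₀) (X i ω)| ≤ R₀)
    {φ : ℝ → ℝ} (hφ : IsInfluence φ) (ν : ℝ) :
    ∫⁻ ω, ENNReal.ofReal (trExp (centredSum φ ν (popCov π) Θ₀ Θs (fun i => X i ω)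
        fun i => traceInner Θs (X i ω) + η i ω)) ∂μ
      ≤ ENNReal.ofReal ((d₁ + d₂) *
        Real.exp (n * (ν ^ 2 * ((σ ^ 2 + R₀ ^ 2) * BQ (popCov π)) / 2))) := by
  set v := ν ^ 2 * ((σ ^ 2 + R₀ ^ 2) * BQ (popCov π)) / 2
  set g : Matrix (Fin d₁) (Fin d₂) ℝ × ℝ → Matrix (Fin d₁ ⊕ Fin d₂) (Fin d₁ ⊕ Fin d₂) ℝ :=
    fun p => cfc (oddPart φ)
      (ν • dilation (oneSample (popCov π) Θ₀ p.1 (traceInner Θs p.1 + p.2))) with hg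
  have hsm : ∀ (c : ℝ) (M : Matrix (Fin d₁) (Fin d₂) ℝ), (c • dilation M).IsHermitian :=
    fun c M => by rw [← dilation_smul]; exact isHermitian_dilation _
  have hgm : Measurable g := measurable_cfc hφ.oddPart.continuous
    ((measurable_dilation.comp (measurable_oneSample _ Θ₀ Θs)).const_smul ν) fun p => hsm _ _
  -- Starting from minus the total mean cancels the means of all `n` samples. What remains is a
  -- multiple of the identity, whose trace exponential is explicit.
  have h := lintegral_trExp_sum_le (μ := μ) (Y := fun i ω => g (X i ω, η i ω))
    (C := fun _ => ν • dilation (Θs - Θ₀) + v • 1)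
    (fun i => hgm.comp ((hX i).prodMk (hη i).measurable)) (fun i ω => isHermitian_cfc _ _)
    (hind.comp (fun _ => g) fun _ => hgm)
    (fun i => (hsm _ _).add (isHermitian_smul_one _))
    (fun i S hS => lintegral_trExp_oneSample_le hQ (hX i) (hXπ i) (hC i) (hη i) (hR i)
      hφ.oddPart ν hS) Finset.univ (-((n * ν) • dilation (Θs - Θ₀))) (hsm _ _).neg
  refine h.trans (ENNReal.ofReal_le_ofReal (le_of_eq ?_))
  rw [Finset.sum_const, Finset.card_univ, Fintype.card_fin, smul_add, ← Nat.cast_smul_eq_nsmul ℝ,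
    ← Nat.cast_smul_eq_nsmul ℝ, smul_smul, smul_smul, neg_add_cancel_left, trExp_smul_one]
  simp

/-- Markov's inequality for a trace exponential. -/
theorem one_sub_le_measureReal_le_exp [NeZero d₁] [NeZero d₂] {Z : Ω → ℝ} {L δ : ℝ}
    (hδ : 0 < δ) (hL : L = Real.log (2 * (max d₁ d₂ : ℕ) / δ)) (hL0 : 0 ≤ L) (hZm : Measurable Z)
    (hZ : ∫⁻ ω, ENNReal.ofReal (Z ω) ∂μ ≤ ENNReal.ofReal ((d₁ + d₂) * Real.exp (L / 2))) :
    1 - δ ≤ μ.real {ω | Z ω ≤ Real.exp (2 * L)} := by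
  have hms : MeasurableSet {ω | Z ω ≤ Real.exp (2 * L)} := measurableSet_le hZm measurable_const
  have hd : (0 : ℝ) < (max d₁ d₂ : ℕ) := by
    exact_mod_cast (NeZero.pos d₁).trans_le (le_max_left _ _)
  have h1 : ENNReal.ofReal (Real.exp (2 * L)) * μ {ω | Z ω ≤ Real.exp (2 * L)}ᶜ
      ≤ ENNReal.ofReal ((d₁ + d₂) * Real.exp (L / 2)) := by
    refine le_trans ?_ ((mul_meas_ge_le_lintegral (μ := μ) (ENNReal.measurable_ofReal.comp hZm)
      (ENNReal.ofReal (Real.exp (2 * L)))).trans hZ)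
    refine mul_le_mul_right (measure_mono fun ω hω => ?_) _
    exact ENNReal.ofReal_le_ofReal (not_le.1 (show ¬ Z ω ≤ Real.exp (2 * L) from hω)).le
  have h2 : Real.exp (2 * L) * μ.real {ω | Z ω ≤ Real.exp (2 * L)}ᶜ
      ≤ (d₁ + d₂) * Real.exp (L / 2) := by
    have := ENNReal.toReal_mono ENNReal.ofReal_ne_top h1
    rwa [ENNReal.toReal_mul, ENNReal.toReal_ofReal (Real.exp_pos _).le,
      ENNReal.toReal_ofReal (by positivity)] at this
  have h3 : Real.exp L = 2 * (max d₁ d₂ : ℕ) / δ := by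
    rw [hL, Real.exp_log (by positivity)]
  have h4 : ((d₁ : ℝ) + d₂) ≤ δ * Real.exp L := by
    rw [h3, mul_div_cancel₀ _ hδ.ne']
    have e1 : (d₁ : ℝ) ≤ (max d₁ d₂ : ℕ) := by exact_mod_cast le_max_left _ _
    have e2 : (d₂ : ℝ) ≤ (max d₁ d₂ : ℕ) := by exact_mod_cast le_max_right _ _
    linarith
  -- As `d₁ + d₂ ≤ 2d = δ exp L`, an exponent `3L/2` would already do; the level `2L` leaves room.
  have h5 : (d₁ + d₂) * Real.exp (L / 2) ≤ Real.exp (2 * L) * δ := by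
    have e1 : Real.exp (L / 2) ≤ Real.exp L := Real.exp_le_exp.2 (by linarith)
    calc (d₁ + d₂) * Real.exp (L / 2) ≤ δ * Real.exp L * Real.exp L :=
          mul_le_mul h4 e1 (Real.exp_pos _).le (by positivity)
      _ = Real.exp (2 * L) * δ := by rw [two_mul, Real.exp_add]; ring
  have h6 := le_of_mul_le_mul_left (h2.trans h5) (Real.exp_pos _)
  rw [measureReal_compl hms, probReal_univ] at h6
  linarith

end Estimator

end LowPopArt

/-! ### Assembly of the error bounds. -/

theorem mainTheorem3 {d₁ d₂ : ℕ} (hd₁ : 0 < d₁) (hd₂ : 0 < d₂)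
    -- arm set and sampling distribution
    (𝒜 : Set (Matrix (Fin d₁) (Fin d₂) ℝ)) (h𝒜 : ∃ C : ℝ, ∀ A ∈ 𝒜, LowPopArt.frobNorm A ≤ C)
    (π : Measure (Matrix (Fin d₁) (Fin d₂) ℝ)) [IsProbabilityMeasure π] (hπ : ∀ᵐ A ∂π, A ∈ 𝒜)
    (hQ : IsUnit (LowPopArt.popCov π))
    -- unknown parameter, pilot estimate and its error
    (r : ℕ) (Θs Θ₀ : Matrix (Fin d₁) (Fin d₂) ℝ) (hr : Θs.rank ≤ r)
    (R₀ : ℝ) (hR₀ : 0 ≤ R₀) (hΘ₀ : ∀ A ∈ 𝒜, |LowPopArt.traceInner (Θ₀ - Θs) A| ≤ R₀)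
    (σ : ℝ) (hσ : 0 ≤ σ) (hσR : 0 < σ ^ 2 + R₀ ^ 2)
    (φ : ℝ → ℝ) (hφ : LowPopArt.IsInfluence φ)
    (δ : ℝ) (hδ₀ : 0 < δ) (hδ₁ : δ < 1)
    -- the sample
    {Ω : Type*} [MeasurableSpace Ω] (μ : Measure Ω) [IsProbabilityMeasure μ]
    (n : ℕ) (hn : 0 < n)
    (X : Fin n → Ω → Matrix (Fin d₁) (Fin d₂) ℝ) (η : Fin n → Ω → ℝ)
    (hX : ∀ i, Measurable (X i)) (hXπ : ∀ i, μ.map (X i) = π)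
    (hη : ∀ i, LowPopArt.IsNoise μ σ (X i) (η i))
    (hind : iIndepFun (fun i ω => (X i ω, η i ω)) μ) :
    let Q := LowPopArt.popCov π
    let L : ℝ := Real.log (2 * (max d₁ d₂ : ℕ) / δ)
    let Θhat : Ω → Matrix (Fin d₁) (Fin d₂) ℝ := fun ω =>
      LowPopArt.lowPopArt φ Q σ R₀ δ Θ₀ (fun i => X i ω)
        (fun i => LowPopArt.traceInner Θs (X i ω) + η i ω)
    ∃ E : Set Ω, MeasurableSet E ∧ 1 - δ ≤ μ.real E ∧ ∀ ω ∈ E,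
      LowPopArt.nuclearNorm (Θhat ω - Θs) ≤
          8 * r * √((σ ^ 2 + R₀ ^ 2) * LowPopArt.BQ Q * L / n) ∧
        LowPopArt.frobNorm (Θhat ω - Θs) ≤
          4 * √(2 * r) * √((σ ^ 2 + R₀ ^ 2) * LowPopArt.BQ Q * L / n) := by
  intro Q L Θhat
  have : NeZero d₁ := ⟨hd₁.ne'⟩
  have : NeZero d₂ := ⟨hd₂.ne'⟩
  obtain ⟨C, hC⟩ := h𝒜
  have hmem : ∀ i, ∀ᵐ ω ∂μ, X i ω ∈ 𝒜 := fun i =>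
    ae_of_ae_map (hX i).aemeasurable (by rw [hXπ i]; exact hπ)
  have hXC : ∀ i, ∀ᵐ ω ∂μ, ∀ k l, |X i ω k l| ≤ C := fun i => by
    filter_upwards [hmem i] with ω hω k l
    exact (LowPopArt.abs_entry_le_frobNorm _ k l).trans (hC _ hω)
  have hR : ∀ i, ∀ᵐ ω ∂μ, |LowPopArt.traceInner (Θs - Θ₀) (X i ω)| ≤ R₀ := fun i => by
    filter_upwards [hmem i] with ω hω
    have h := hΘ₀ _ hω
    rw [← abs_neg] at h
    convert h using 2
    simp only [LowPopArt.traceInner_eq, vec_sub, sub_dotProduct]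
    ring
  have hV : 0 < (σ ^ 2 + R₀ ^ 2) * LowPopArt.BQ Q := mul_pos hσR
    (LowPopArt.BQ_pos (LowPopArt.popCov_posDef (hX ⟨0, hn⟩) (hXπ ⟨0, hn⟩) (hXC ⟨0, hn⟩) hQ))
  have hL : 0 < L := by
    have hd : (1 : ℝ) ≤ (max d₁ d₂ : ℕ) := by exact_mod_cast hd₁.trans_le (le_max_left _ _)
    refine Real.log_pos ?_
    rw [lt_div_iff₀ hδ₀]
    linarith
  have hn' : (0 : ℝ) < n := by exact_mod_cast hn
  set ν := LowPopArt.truncParam Q σ R₀ δ n with hνdef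
  have hν : 0 < ν := Real.sqrt_pos.2 (by positivity)
  have hτ : n * ν * LowPopArt.threshold Q σ R₀ δ n = 2 * L :=
    LowPopArt.truncParam_mul_threshold hV hL hn
  -- This choice of `ν` makes the accumulated variance term `L / 2`, while the threshold corresponds
  -- to the eigenvalue level `2L`.
  have hvar : n * (ν ^ 2 * ((σ ^ 2 + R₀ ^ 2) * LowPopArt.BQ Q) / 2) = L / 2 := by
    have : ν ^ 2 = L / ((σ ^ 2 + R₀ ^ 2) * LowPopArt.BQ Q * n) := Real.sq_sqrt (by positivity)
    rw [this]
    generalize (σ ^ 2 + R₀ ^ 2) * LowPopArt.BQ Q = V at *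
    field_simp
  set P : Ω → Matrix (Fin d₁ ⊕ Fin d₂) (Fin d₁ ⊕ Fin d₂) ℝ := fun ω =>
    LowPopArt.centredSum φ ν Q Θ₀ Θs (fun i => X i ω)
      fun i => LowPopArt.traceInner Θs (X i ω) + η i ω with hP
  have hPs : ∀ ω, (P ω).IsHermitian := fun ω => LowPopArt.isHermitian_centredSum _ _ _ _ _ _ _
  have hZm : Measurable fun ω => LowPopArt.trExp (P ω) := LowPopArt.measurable_trExp
    (LowPopArt.measurable_centredSum hφ ν Q Θ₀ Θs hX fun i => (hη i).measurable) hPs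
  have hZ := LowPopArt.lintegral_trExp_centredSum_le hQ hX hXπ hXC hη hind hR hφ ν
  rw [hvar] at hZ
  refine ⟨{ω | LowPopArt.trExp (P ω) ≤ Real.exp (2 * L)}, measurableSet_le hZm measurable_const,
    LowPopArt.one_sub_le_measureReal_le_exp hδ₀ rfl hL.le hZm hZ, fun ω hω => ?_⟩
  have hpsd : ((2 * L) • (1 : Matrix (Fin d₁ ⊕ Fin d₂) (Fin d₁ ⊕ Fin d₂) ℝ) - P ω).PosSemidef := by
    have h1 := LowPopArt.posSemidef_log_trExp_sub (hPs ω)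
    have h2 : 0 < LowPopArt.trExp (P ω) := by
      rw [LowPopArt.trExp, LowPopArt.trace_cfc (hPs ω)]
      exact Finset.sum_pos (fun i _ => Real.exp_pos _) ⟨Sum.inl 0, Finset.mem_univ _⟩
    have h3 : Real.log (LowPopArt.trExp (P ω)) ≤ 2 * L :=
      (Real.log_le_iff_le_exp h2).2 hω
    have h4 := (PosSemidef.one (n := Fin d₁ ⊕ Fin d₂) (R := ℝ)).smul (sub_nonneg.2 h3)
    have h5 := h4.add h1
    rwa [sub_smul, sub_add_sub_cancel] at h5
  have hop := LowPopArt.norm_robustMean_sub_le hn hν (by positivity) hτ hpsd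
  have hτ0 : 0 ≤ LowPopArt.threshold Q σ R₀ δ n :=
    mul_nonneg zero_le_two (Real.sqrt_nonneg _)
  obtain ⟨b1, b2⟩ := LowPopArt.hardThreshold_error_le hτ0 hop hr
  have e : LowPopArt.threshold Q σ R₀ δ n
      = 2 * √((σ ^ 2 + R₀ ^ 2) * LowPopArt.BQ Q * L / n) := rfl
  rw [e] at b1 b2
  -- The factors `8r` and `4√(2r)` are rank `2r`, respectively `√(2r)`, times `2λ`, where `λ` itself
  -- carries a factor `2`.
  refine ⟨le_trans b1 (le_of_eq ?_), le_trans b2 (le_of_eq ?_)⟩ <;> ring
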